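/- Let $\Omega=\{0,1\}^{\mathbb N}$ be Cantor space, $\Gamma_x\subseteq\Omega$ the set of infinite sequences extending the finite binary sequence $x$, and let $P$ be a computable Borel probability measure on $\Omega$, i.e. $x\mapsto P(\Gamma_x)$ is the limit both of a computable non-decreasing and of a computable non-increasing sequence of rational-valued functions of $x$. Let $f:\Omega\to[0,\infty)$ be a $P$-integrable function that is computable, i.e. $f$ is the everywhere pointwise limit both of a computable non-decreasing and of a computable non-increasing sequence of simple functions (functions taking constant rational values on the members of a finite cover of $\Omega$ by intervals $\Gamma_x$). Let $T:\Omega\to\Omega$ be a $P$-preserving transformation that is computable, i.e. there is a recursively enumerable set $\hat T$ of pairs of finite binary sequences such that (i) if $(x,y),(x',y')\in\hat T$ and $x$ is a prefix of $x'$, then one of $y,y'$ is a prefix of the other; (ii) if $(x,y)\in\hat T$ and $y'$ is a prefix of $y$, then $(x,y')\in\hat T$; (iii) $(x,\lambda)\in\hat T$ for every $x$, where $\lambda$ is the empty sequence; (iv) for every $\omega\in\Omega$, $T\omega$ is the supremum, in the prefix order, of all $y$ with $(x,y)\in\hat T$ for some prefix $x$ of $\omega$. A point $\omega\in\Omega$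 is Martin-Löf $P$-random if $\omega\notin\bigcap_n U_n$ for every sequence $(U_n)$ of uniformly effectively open sets (unions of intervals $\Gamma_x$ enumerated by one algorithm uniformly in $n$) with $P(U_n)\le 2^{-n}$ for all $n$. Then there is a $P$-integrable function $\tilde f:\Omega\to\mathbb R$, invariant under $T$ (that is, $\tilde f(T\omega)=\tilde f(\omega)$ for all $\omega$), with $\int\tilde f\,dP=\int f\,dP$, such that $$\lim_{n\to\infty}\frac1n\sum_{k=0}^{n-1}f(T^k\omega)=\tilde f(\omega)$$ for every Martin-Löf $P$-random $\omega$. Moreover, if $T$ is ergodic with respect to $P$, then $\tilde f(\omega)=\int f\,dP$ for every Martin-Löf $P$-random $\omega$. -/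

import Mathlib

namespace AlgorithmicErgodic

/-! ### Cantor space and rational codes -/

/-- The Cantor space `Ω` of infinite binary sequences, with Mathlib's product topology and
product (= Borel) σ-algebra. -/
abbrev Cantor : Type := ℕ → Bool

/-- The finite sequence `x` is an initial segment of the infinite sequence `ω`. -/
def IsPrefix (x : List Bool) (ω : Cantor) : Prop :=
  ∀ (i : ℕ) (hi : i < x.length), x[i] = ω i

instance (x : List Bool) (ω : Cantor) : Decidable (IsPrefix x ω) :=
  inferInstanceAs (Decidable (∀ (i : ℕ) (hi : i < x.length), x[i] = ω i))

/-- The interval `Γ_x` of all infinite sequences that extend `x`. -/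
def cylinder (x : List Bool) : Set Cantor := {ω | IsPrefix x ω}

/-- Rational numbers as finite objects: the triple `((a, b), c)` names `(a - b) / (c + 1)`. -/
abbrev RatCode : Type := (ℕ × ℕ) × ℕ

/-- The rational number with a given name; every rational number has a name. -/
def RatCode.val (r : RatCode) : ℚ := ((r.1.1 : ℚ) - (r.1.2 : ℚ)) / ((r.2 : ℚ) + 1)

/-! ### Computable real functions of a finite object, computable measures -/

/-- A real function of a finite object is lower semicomputable if it is the limit of a computable
non-decreasing sequence of rational functions. -/
def LowerSemicomputable {A : Type} [Primcodable A] (g : A → ℝ) : Prop :=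
  ∃ h : ℕ → A → RatCode, Computable₂ h ∧
    (∀ n x, (h n x).val ≤ (h (n + 1) x).val) ∧
    ∀ x, Filter.Tendsto (fun n => (((h n x).val : ℚ) : ℝ)) Filter.atTop (nhds (g x))

/-- A real function of a finite object is upper semicomputable if it is the limit of a computable
non-increasing sequence of rational functions. -/
def UpperSemicomputable {A : Type} [Primcodable A] (g : A → ℝ) : Prop :=
  ∃ h : ℕ → A → RatCode, Computable₂ h ∧
    (∀ n x, (h (n + 1) x).val ≤ (h n x).val) ∧
    ∀ x, Filter.Tendsto (fun n => (((h n x).val : ℚ) : ℝ)) Filter.atTop (nhds (g x))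

/-- A measure on Cantor space is computable if `x ↦ P(Γ_x)` is lower and upper semicomputable. -/
def ComputableMeasure (P : MeasureTheory.Measure Cantor) : Prop :=
  LowerSemicomputable (fun x : List Bool => P.real (cylinder x)) ∧
    UpperSemicomputable (fun x : List Bool => P.real (cylinder x))

/-! ### Martin-Löf randomness -/

/-- A sequence of sets is uniformly effectively open if `U n` is the union of the intervals
`Γ_{x_{n,i}}`, `i = 0, 1, …`, where `(n, i) ↦ x_{n,i}` is partial recursive (an undefined
`x_{n,i}` contributes nothing, so that `U n` may be empty). -/
def UniformlyEffectivelyOpen (U : ℕ → Set Cantor) : Prop :=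
  ∃ e : ℕ → ℕ →. List Bool, Partrec₂ e ∧
    ∀ n, U n = {ω | ∃ i, ∃ x ∈ e n i, ω ∈ cylinder x}

/-- A Martin-Löf test with respect to `P`. -/
def IsMartinLofTest (P : MeasureTheory.Measure Cantor) (U : ℕ → Set Cantor) : Prop :=
  UniformlyEffectivelyOpen U ∧ ∀ n, P (U n) ≤ (2⁻¹ : ENNReal) ^ n

/-- `ω` is Martin-Löf random with respect to `P` if it passes every Martin-Löf test. -/
def IsMartinLofRandom (P : MeasureTheory.Measure Cantor) (ω : Cantor) : Prop :=
  ∀ U : ℕ → Set Cantor, IsMartinLofTest P U → ω ∉ ⋂ n, U n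

/-! ### Computable functions on Cantor space -/

/-- Simple functions as finite objects: a list of pairs (interval, rational value). -/
abbrev SimpleCode : Type := List (List Bool × RatCode)

/-- The simple function with a given code: its value at `ω` is the one attached to the first
listed interval that contains `ω`, and `0` if there is none. The functions so obtained are exactly
those which take constant rational values on the members of a finite cover by intervals. -/
def SimpleCode.eval : SimpleCode → Cantor → ℚ
  | [], _ => 0
  | (x, r) :: l, ω => if IsPrefix x ω then r.val else SimpleCode.eval l ω

/-- `f : Ω → ℝ` is lower semicomputable if it is the pointwise limit of a computable
non-decreasing sequence of simple functions. -/
def LowerSemicomputableFun (f : Cantor → ℝ) : Prop :=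
  ∃ h : ℕ → SimpleCode, Computable h ∧
    (∀ n ω, SimpleCode.eval (h n) ω ≤ SimpleCode.eval (h (n + 1)) ω) ∧
    ∀ ω, Filter.Tendsto (fun n => ((SimpleCode.eval (h n) ω : ℚ) : ℝ)) Filter.atTop (nhds (f ω))

/-- `f : Ω → ℝ` is upper semicomputable if it is the pointwise limit of a computable
non-increasing sequence of simple functions. -/
def UpperSemicomputableFun (f : Cantor → ℝ) : Prop :=
  ∃ h : ℕ → SimpleCode, Computable h ∧
    (∀ n ω, SimpleCode.eval (h (n + 1)) ω ≤ SimpleCode.eval (h n) ω) ∧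
    ∀ ω, Filter.Tendsto (fun n => ((SimpleCode.eval (h n) ω : ℚ) : ℝ)) Filter.atTop (nhds (f ω))

/-- `f : Ω → ℝ` is computable if it is lower and upper semicomputable. -/
def ComputableFun (f : Cantor → ℝ) : Prop :=
  LowerSemicomputableFun f ∧ UpperSemicomputableFun f

/-! ### Computable transformations -/

/-- A computable representation of a transformation: a recursively enumerable set of pairs of
finite sequences with the usual compatibility conditions; `<+:` is the prefix order on lists. -/
structure IsComputableRepresentation (R : Set (List Bool × List Bool)) : Prop where
  re : REPred fun p : List Bool × List Bool => p ∈ R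
  compatible : ∀ x y x' y', (x, y) ∈ R → (x', y') ∈ R → x <+: x' → y <+: y' ∨ y' <+: y
  closed : ∀ x y y', (x, y) ∈ R → y' <+: y → (x, y') ∈ R
  nil_mem : ∀ x, (x, []) ∈ R

/-- `T : Ω → Ω` is computable if for some computable representation `R` and every `ω` the infinite
sequence `T ω` is the supremum, in the prefix order, of `{y | ∃ x ⊆ ω, (x, y) ∈ R}`: every such
`y` is a prefix of `T ω`, and such `y` have arbitrarily large length. -/
def ComputableTransformation (T : Cantor → Cantor) : Prop :=
  ∃ R : Set (List Bool × List Bool), IsComputableRepresentation R ∧ ∀ ω : Cantor,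
    (∀ x y, IsPrefix x ω → (x, y) ∈ R → IsPrefix y (T ω)) ∧
    ∀ n : ℕ, ∃ x y, IsPrefix x ω ∧ (x, y) ∈ R ∧ n ≤ y.length

end AlgorithmicErgodic

/-! The proof makes Birkhoff's theorem effective through upcrossings. If the averages of `f` diverge
at `ω`, they cross some rational gap `α < β` upwards infinitely often. Bishop's inequality
(`mul_measureReal_upcrossingSet_le`) bounds the measure of the points with `N` upcrossings by a
constant over `N * (β - α)`. These sets are effectively open uniformly in `N`, so letting `N` grow
like `2 ^ k` turns them into a Martin-Löf test, which catches every point of divergence. This bound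
needs no rate of convergence, which in general cannot be computed.

Bishop's inequality has a trading proof. Let `m ω` be the best profit from at most `N` disjoint
trades, buying at `S_u - u * α` and selling at `S_v - v * β`, where `S` is the Birkhoff sum along
the orbit of `ω`. Moving all trades one step along the orbit raises the profit by `β - α` per trade,
up to one boundary error `c ≥ f - α`. Where there are `N` upcrossings, an optimal plan may be
assumed to have exactly `N` trades. Hence `m + N * (β - α) * 1_E ≤ m ∘ T + c`, and integration
cancels `m` against `m ∘ T`.

Effectivity is carried by `EffOpen`: these families are closed under finite intersections, unions
and preimages under iterates of `T`. An upper semicomputable `f` makes "average below `α`"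
effectively open, and a lower semicomputable `f` does so for "average above `β`".

In the ergodic case, suppose that the limit at a random point lies on the wrong side of a rational
`r`. The open sets of averages on the typical side of `r` have measure tending to 1. Since `P` is
approximable from below, times at which this measure exceeds `1 - 2 ^ (-k)` can be found by search.
At these times the opposite sets are small, and they form a test containing the point
(`IsMartinLofRandom.not_eventually_mem`). -/

/-! ### Recursively enumerable predicates -/

section RE

open Encodable

variable {A B : Type*} [Primcodable A] [Primcodable B]

/-- A predicate is recursively enumerable iff it is the projection of a primitive recursive
relation. -/
theorem rePred_iff_exists_primrecRel {p : A → Prop} :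
    REPred p ↔ ∃ s : A → ℕ → Prop, PrimrecRel s ∧ ∀ a, p a ↔ ∃ n, s a n := by
  constructor
  · intro h
    obtain ⟨c, hc⟩ := Nat.Partrec.Code.exists_code.1 h
    refine ⟨fun a k => (Nat.Partrec.Code.evaln k c (encode a)).isSome = true, ?_, fun a => ?_⟩
    · refine (Primrec.primrecPred (p := fun x : A × ℕ =>
        (Nat.Partrec.Code.evaln x.2 c (encode x.1)).isSome = true) ?_).primrecRel
      simp only [Bool.decide_eq_true]
      exact Primrec.option_isSome.comp (Nat.Partrec.Code.primrec_evaln.comp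
        ((Primrec.snd.pair (Primrec.const c)).pair (Primrec.encode.comp Primrec.fst)))
    · have h1 : p a ↔ (c.eval (encode a)).Dom := by
        rw [hc]; simp [Part.assert]
      rw [h1, Part.dom_iff_mem]
      simp only [Nat.Partrec.Code.evaln_complete, Option.isSome_iff_exists, Option.mem_def]
      exact exists_comm
  · rintro ⟨s, hs, h⟩
    classical
    have h1 : Computable₂ fun a n => decide (s a n) :=
      (primrecRel_iff_primrec_decide.1 hs).to_comp
    have h2 : Partrec fun a => Nat.rfind fun n => Part.some (decide (s a n)) :=
      Partrec.rfind h1.partrec₂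
    refine h2.dom_re.of_eq fun a => ?_
    rw [h a]
    refine Nat.rfind_dom'.trans ?_
    simp

theorem PrimrecPred.rePred {p : A → Prop} (hp : PrimrecPred p) : REPred p :=
  hp.computablePred.to_re

theorem REPred.comp {p : B → Prop} (hp : REPred p) {g : A → B} (hg : Computable g) :
    REPred fun a => p (g a) :=
  Partrec.comp hp hg

theorem REPred.and {p q : A → Prop} (hp : REPred p) (hq : REPred q) :
    REPred fun a => p a ∧ q a := by
  obtain ⟨s, hs, hps⟩ := rePred_iff_exists_primrecRel.1 hp
  obtain ⟨t, ht, hqt⟩ := rePred_iff_exists_primrecRel.1 hq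
  refine rePred_iff_exists_primrecRel.2
    ⟨fun a n => s a n.unpair.1 ∧ t a n.unpair.2, ?_, fun a => ?_⟩
  · exact PrimrecPred.and
      (hs.comp Primrec.fst (Primrec.fst.comp (Primrec.unpair.comp Primrec.snd)))
      (ht.comp Primrec.fst (Primrec.snd.comp (Primrec.unpair.comp Primrec.snd)))
  · rw [hps, hqt]
    constructor
    · rintro ⟨⟨n, hn⟩, m, hm⟩
      exact ⟨Nat.pair n m, by simpa using ⟨hn, hm⟩⟩
    · rintro ⟨n, hn⟩
      exact ⟨⟨_, hn.1⟩, _, hn.2⟩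

theorem REPred.or {p q : A → Prop} (hp : REPred p) (hq : REPred q) :
    REPred fun a => p a ∨ q a := by
  obtain ⟨s, hs, hps⟩ := rePred_iff_exists_primrecRel.1 hp
  obtain ⟨t, ht, hqt⟩ := rePred_iff_exists_primrecRel.1 hq
  refine rePred_iff_exists_primrecRel.2 ⟨fun a n => s a n ∨ t a n, PrimrecPred.or hs ht, fun a => ?_⟩
  rw [hps, hqt, exists_or]

theorem REPred.exists {p : A × B → Prop} (hp : REPred p) : REPred fun a => ∃ b, p (a, b) := by
  obtain ⟨s, hs, hps⟩ := rePred_iff_exists_primrecRel.1 hp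
  classical
  refine rePred_iff_exists_primrecRel.2
    ⟨fun a n => ∃ b ∈ (decode (α := B) n.unpair.1).toList, s (a, b) n.unpair.2, ?_, fun a => ?_⟩
  · have h1 : PrimrecRel fun (l : List B) (y : A × ℕ) => ∃ b ∈ l, s (y.1, b) y.2.unpair.2 := by
      refine PrimrecRel.exists_mem_list (R := fun b (y : A × ℕ) => s (y.1, b) y.2.unpair.2) ?_
      exact hs.comp ((Primrec.fst.comp Primrec.snd).pair Primrec.fst)
        (Primrec.snd.comp (Primrec.unpair.comp (Primrec.snd.comp Primrec.snd)))
    exact h1.comp (f := fun x : A × ℕ => (decode (α := B) x.2.unpair.1).toList) (g := fun x => x)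
      (Primrec.optionToList.comp (Primrec.decode.comp
        (Primrec.fst.comp (Primrec.unpair.comp Primrec.snd)))) Primrec.id
  · constructor
    · rintro ⟨b, hb⟩
      obtain ⟨n, hn⟩ := (hps _).1 hb
      exact ⟨Nat.pair (encode b) n, b, by simp, by simpa using hn⟩
    · rintro ⟨n, b, -, hn⟩
      exact ⟨b, (hps _).2 ⟨_, hn⟩⟩

/-- Finitely many witnesses have a common bound, so the quantifier over the list can be moved inside
a single search for that bound. -/
theorem REPred.forall_mem_list {p : A × B → Prop} (hp : REPred p) :
    REPred fun x : A × List B => ∀ b ∈ x.2, p (x.1, b) := by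
  obtain ⟨s, hs, hps⟩ := rePred_iff_exists_primrecRel.1 hp
  refine rePred_iff_exists_primrecRel.2
    ⟨fun x m => ∀ b ∈ x.2, ∃ t < m, s (x.1, b) t, ?_, fun x => ?_⟩
  · have h1 : PrimrecRel fun (m : ℕ) (y : A × B) => ∃ t < m, s y t :=
      ((PrimrecRel.exists_mem_list (R := fun t (y : A × B) => s y t) hs.swap).comp
        (Primrec.list_range.comp Primrec.fst) Primrec.snd).of_eq fun x => by simp
    have h2 : PrimrecRel fun (n : List B) (y : A × ℕ) => ∀ b ∈ n, ∃ t < y.2, s (y.1, b) t :=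
      PrimrecRel.forall_mem_list (R := fun b (y : A × ℕ) => ∃ t < y.2, s (y.1, b) t)
        (h1.comp (Primrec.snd.comp Primrec.snd) ((Primrec.fst.comp Primrec.snd).pair Primrec.fst))
    exact h2.comp (f := fun z : (A × List B) × ℕ => z.1.2) (g := fun z => (z.1.1, z.2))
      (Primrec.snd.comp Primrec.fst) ((Primrec.fst.comp Primrec.fst).pair Primrec.snd)
  · simp only [hps]
    constructor
    · intro h
      classical
      choose! t ht using h
      refine ⟨x.2.toFinset.sup t + 1, fun b hb => ⟨t b, ?_, ht b hb⟩⟩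
      exact Nat.lt_succ_of_le (Finset.le_sup (f := t) (List.mem_toFinset.2 hb))
    · rintro ⟨m, h⟩ b hb
      obtain ⟨t, -, ht⟩ := h b hb
      exact ⟨t, ht⟩

theorem REPred.forall_lt {p : A × ℕ → Prop} (hp : REPred p) :
    REPred fun x : A × ℕ => ∀ i < x.2, p (x.1, i) :=
  (REPred.comp (REPred.forall_mem_list hp) (g := fun x : A × ℕ => (x.1, List.range x.2))
    (Primrec.fst.pair (Primrec.list_range.comp Primrec.snd)).to_comp).of_eq fun x => by
      simp

/-- A total recursively enumerable relation has a computable choice function. -/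
theorem REPred.exists_computable_choice {p : A × ℕ → Prop} (hp : REPred p)
    (h : ∀ a, ∃ n, p (a, n)) : ∃ g : A → ℕ, Computable g ∧ ∀ a, p (a, g a) := by
  obtain ⟨s, hs, hps⟩ := rePred_iff_exists_primrecRel.1 hp
  classical
  -- Only `s` is decidable, so the search runs over codes of pairs: a candidate together with a
  -- witness for it.
  have hex : ∀ a, ∃ m : ℕ, s (a, m.unpair.1) m.unpair.2 := by
    intro a
    obtain ⟨n, hn⟩ := h a
    obtain ⟨t, ht⟩ := (hps _).1 hn
    exact ⟨Nat.pair n t, by simpa using ht⟩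
  have hd : PrimrecPred fun x : A × ℕ => s (x.1, x.2.unpair.1) x.2.unpair.2 :=
    hs.comp (Primrec.fst.pair (Primrec.fst.comp (Primrec.unpair.comp Primrec.snd)))
      (Primrec.snd.comp (Primrec.unpair.comp Primrec.snd))
  have h3 : Computable fun a => Nat.find (hex a) :=
    Computable.find (P := fun a m => s (a, m.unpair.1) m.unpair.2) hd.computablePred hex
  refine ⟨fun a => (Nat.find (hex a)).unpair.1, ?_, fun a => (hps _).2 ⟨_, Nat.find_spec (hex a)⟩⟩
  exact Computable.fst.comp (Primrec.unpair.to_comp.comp h3)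

end RE

namespace AlgorithmicErgodic

open Encodable

/-! ### Finite and infinite binary sequences -/

/-- The initial segment of length `n` of an infinite binary sequence. -/
def initSeg (ω : Cantor) (n : ℕ) : List Bool := (List.range n).map ω

@[simp] theorem length_initSeg (ω : Cantor) (n : ℕ) : (initSeg ω n).length = n := by
  simp [initSeg]

theorem isPrefix_initSeg (ω : Cantor) (n : ℕ) : IsPrefix (initSeg ω n) ω := by
  intro i hi
  simp [initSeg]

theorem isPrefix_iff_eq_initSeg {x : List Bool} {ω : Cantor} :
    IsPrefix x ω ↔ x = initSeg ω x.length := by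
  constructor
  · intro h
    refine List.ext_getElem (by simp) fun i h1 h2 => ?_
    rw [h i h1, isPrefix_initSeg ω _ i h2]
  · intro h
    rw [h]
    exact isPrefix_initSeg _ _

theorem initSeg_prefix {ω : Cantor} {m n : ℕ} (h : m ≤ n) : initSeg ω m <+: initSeg ω n := by
  rw [List.prefix_iff_eq_take, length_initSeg, initSeg, initSeg, ← List.map_take, List.take_range,
    min_eq_left h]

theorem IsPrefix.of_prefix {x y : List Bool} {ω : Cantor} (hy : IsPrefix y ω) (h : x <+: y) :
    IsPrefix x ω := by
  intro i hi
  rw [h.getElem hi]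
  exact hy i _

theorem IsPrefix.prefix_of_length_le {x y : List Bool} {ω : Cantor} (hx : IsPrefix x ω)
    (hy : IsPrefix y ω) (h : x.length ≤ y.length) : x <+: y := by
  rw [isPrefix_iff_eq_initSeg.1 hx, isPrefix_iff_eq_initSeg.1 hy]
  exact initSeg_prefix h

theorem IsPrefix.prefix_initSeg {x : List Bool} {ω : Cantor} (hx : IsPrefix x ω) {n : ℕ}
    (h : x.length ≤ n) : x <+: initSeg ω n :=
  hx.prefix_of_length_le (isPrefix_initSeg ω n) (by simpa using h)

theorem primrecRel_prefix : PrimrecRel fun x y : List Bool => x <+: y := by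
  refine PrimrecRel.of_eq (r := fun x y : List Bool => x = y.take x.length)
    (Primrec.eq.comp Primrec.fst
      (Primrec.list_take.comp (Primrec.list_length.comp Primrec.fst) Primrec.snd))
    fun x y => List.prefix_iff_eq_take.symm

/-! ### Effectively open families of sets -/

section EffOpen

variable {A B : Type*} [Primcodable A] [Primcodable B]

/-- A family of subsets of Cantor space is effectively open if it consists of unions of intervals
that are recursively enumerable uniformly in the parameter. -/
def EffOpen (U : A → Set Cantor) : Prop :=
  ∃ S : A × List Bool → Prop, REPred S ∧ ∀ a ω, ω ∈ U a ↔ ∃ x, IsPrefix x ω ∧ S (a, x)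

/-- The enumerated set of strings may be taken closed under extensions. -/
theorem EffOpen.exists_monotone {U : A → Set Cantor} (hU : EffOpen U) :
    ∃ S : A × List Bool → Prop, REPred S ∧ (∀ a x y, x <+: y → S (a, x) → S (a, y)) ∧
      ∀ a ω, ω ∈ U a ↔ ∃ x, IsPrefix x ω ∧ S (a, x) := by
  obtain ⟨S, hS, h⟩ := hU
  refine ⟨fun p => ∃ z, z <+: p.2 ∧ S (p.1, z), ?_, ?_, ?_⟩
  · refine REPred.exists (p := fun q : (A × List Bool) × List Bool => q.2 <+: q.1.2 ∧ S (q.1.1, q.2))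
      (REPred.and (PrimrecPred.rePred ?_) (hS.comp ?_))
    · exact primrecRel_prefix.comp Primrec.snd (Primrec.snd.comp Primrec.fst)
    · exact ((Primrec.fst.comp Primrec.fst).pair Primrec.snd).to_comp
  · rintro a x y hxy ⟨z, hz, hS⟩
    exact ⟨z, hz.trans hxy, hS⟩
  · intro a ω
    rw [h]
    constructor
    · rintro ⟨x, hx, hS⟩
      exact ⟨x, hx, x, List.prefix_rfl, hS⟩
    · rintro ⟨x, hx, z, hz, hS⟩
      exact ⟨z, hx.of_prefix hz, hS⟩

theorem EffOpen.comp {U : B → Set Cantor} (hU : EffOpen U) {g : A → B} (hg : Computable g) :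
    EffOpen fun a => U (g a) := by
  obtain ⟨S, hS, h⟩ := hU
  exact ⟨fun p => S (g p.1, p.2), hS.comp ((hg.comp Computable.fst).pair Computable.snd),
    fun a ω => h _ _⟩

theorem EffOpen.of_eq {U V : A → Set Cantor} (hU : EffOpen U) (h : ∀ a ω, ω ∈ U a ↔ ω ∈ V a) :
    EffOpen V :=
  (funext fun a => Set.ext (h a) : U = V) ▸ hU

theorem EffOpen.of_rePred {p : A → Prop} (hp : REPred p) : EffOpen fun a => {_ω | p a} :=
  ⟨fun q => p q.1, hp.comp Computable.fst, fun a ω =>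
    ⟨fun h => ⟨[], fun i hi => by simp at hi, h⟩, fun ⟨_, _, h⟩ => h⟩⟩

theorem EffOpen.inter {U V : A → Set Cantor} (hU : EffOpen U) (hV : EffOpen V) :
    EffOpen fun a => U a ∩ V a := by
  obtain ⟨S, hS, hSm, h⟩ := hU.exists_monotone
  obtain ⟨S', hS', hSm', h'⟩ := hV.exists_monotone
  refine ⟨fun p => S p ∧ S' p, hS.and hS', fun a ω => ?_⟩
  rw [Set.mem_inter_iff, h, h']
  constructor
  · rintro ⟨⟨x, hx, hSx⟩, y, hy, hSy⟩
    rcases le_total x.length y.length with hl | hl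
    · exact ⟨y, hy, hSm _ _ _ (hx.prefix_of_length_le hy hl) hSx, hSy⟩
    · exact ⟨x, hx, hSx, hSm' _ _ _ (hy.prefix_of_length_le hx hl) hSy⟩
  · rintro ⟨x, hx, h1, h2⟩
    exact ⟨⟨x, hx, h1⟩, x, hx, h2⟩

theorem EffOpen.iUnion {U : A × B → Set Cantor} (hU : EffOpen U) :
    EffOpen fun a => ⋃ b, U (a, b) := by
  obtain ⟨S, hS, h⟩ := hU
  refine ⟨fun p => ∃ b, S ((p.1, b), p.2), ?_, fun a ω => ?_⟩
  · refine REPred.exists (p := fun q : (A × List Bool) × B => S ((q.1.1, q.2), q.1.2)) (hS.comp ?_)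
    exact (((Primrec.fst.comp Primrec.fst).pair Primrec.snd).pair
      (Primrec.snd.comp Primrec.fst)).to_comp
  · simp only [Set.mem_iUnion, h]
    constructor
    · rintro ⟨b, x, hx, hS⟩
      exact ⟨x, hx, b, hS⟩
    · rintro ⟨x, hx, b, hS⟩
      exact ⟨b, x, hx, hS⟩

/-- With the enumerated strings closed under extension, the longest of finitely many witnessing
prefixes of `ω` serves for all members of the list at once. -/
theorem EffOpen.iInter_mem_list {U : A × B → Set Cantor} (hU : EffOpen U) :
    EffOpen fun x : A × List B => {ω | ∀ b ∈ x.2, ω ∈ U (x.1, b)} := by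
  obtain ⟨S, hS, hSm, h⟩ := hU.exists_monotone
  refine ⟨fun p => ∀ b ∈ p.1.2, S ((p.1.1, b), p.2), ?_, fun a ω => ?_⟩
  · have h1 : REPred fun q : (A × List Bool) × B => S ((q.1.1, q.2), q.1.2) :=
      hS.comp (((Primrec.fst.comp Primrec.fst).pair Primrec.snd).pair
        (Primrec.snd.comp Primrec.fst)).to_comp
    exact h1.forall_mem_list.comp (g := fun p : (A × List B) × List Bool => ((p.1.1, p.2), p.1.2))
      (((Primrec.fst.comp Primrec.fst).pair Primrec.snd).pair
        (Primrec.snd.comp Primrec.fst)).to_comp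
  · simp only [Set.mem_ofPred_eq, h]
    constructor
    · intro H
      classical
      choose! x hx hS using H
      set m := a.2.toFinset.sup fun b => (x b).length
      refine ⟨initSeg ω m, isPrefix_initSeg _ _, fun b hb => hSm _ _ _ ?_ (hS b hb)⟩
      exact (hx b hb).prefix_initSeg
        (Finset.le_sup (f := fun b => (x b).length) (List.mem_toFinset.2 hb))
    · rintro ⟨x, hx, H⟩ b hb
      exact ⟨x, hx, H b hb⟩

theorem EffOpen.iInter_lt {U : A × ℕ → Set Cantor} (hU : EffOpen U) :
    EffOpen fun x : A × ℕ => {ω | ∀ i < x.2, ω ∈ U (x.1, i)} :=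
  (hU.iInter_mem_list.comp (g := fun x : A × ℕ => (x.1, List.range x.2))
    (Primrec.fst.pair (Primrec.list_range.comp Primrec.snd)).to_comp).of_eq fun x ω => by simp

/-- Some output at least as long as `y` is reached; it is comparable with `y` because both are
prefixes of `T ω`, and closure of `R` under shortening outputs gives `y` itself. -/
theorem ComputableTransformation.exists_prefix {R : Set (List Bool × List Bool)}
    (hR : IsComputableRepresentation R) {T : Cantor → Cantor} {ω : Cantor}
    (h : (∀ x y, IsPrefix x ω → (x, y) ∈ R → IsPrefix y (T ω)) ∧
      ∀ n : ℕ, ∃ x y, IsPrefix x ω ∧ (x, y) ∈ R ∧ n ≤ y.length)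
    {y : List Bool} (hy : IsPrefix y (T ω)) : ∃ x, IsPrefix x ω ∧ (x, y) ∈ R := by
  obtain ⟨x, z, hx, hxz, hl⟩ := h.2 y.length
  exact ⟨x, hx, hR.closed _ _ _ hxz (hy.prefix_of_length_le (h.1 _ _ hx hxz) hl)⟩

/-- Preimages of an effectively open family under the iterates of a computable transformation. -/
theorem EffOpen.preimage_iterate {U : A → Set Cantor} (hU : EffOpen U) {T : Cantor → Cantor}
    (hT : ComputableTransformation T) : EffOpen fun p : A × ℕ => T^[p.2] ⁻¹' U p.1 := by
  obtain ⟨S, hS, h⟩ := hU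
  obtain ⟨R, hR, hRT⟩ := hT
  -- a chain `l` of `n` strings that leads from `x` to `z` through `R`
  let C : ((A × ℕ) × List Bool) × List (List Bool) → Prop := fun q =>
    (∀ i < q.1.1.2, (q.2.getD i [], q.2.getD (i + 1) []) ∈ R) ∧
      q.2.getD 0 [] = q.1.2 ∧ S (q.1.1.1, q.2.getD q.1.1.2 [])
  have hget : Primrec₂ fun (l : List (List Bool)) i => l.getD i [] := Primrec.list_getD []
  have hC : REPred C := by
    refine REPred.and ?_ (REPred.and (PrimrecPred.rePred ?_) (hS.comp ?_))
    · have h1 : REPred fun q : List (List Bool) × ℕ => (q.1.getD q.2 [], q.1.getD (q.2 + 1) []) ∈ R :=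
        hR.re.comp (Primrec.pair hget (hget.comp Primrec.fst (Primrec.succ.comp Primrec.snd))).to_comp
      exact h1.forall_lt.comp (g := fun q : ((A × ℕ) × List Bool) × List (List Bool) =>
        (q.2, q.1.1.2)) (Primrec.snd.pair
          (Primrec.snd.comp (Primrec.fst.comp Primrec.fst))).to_comp
    · exact Primrec.eq.comp (hget.comp Primrec.snd (Primrec.const 0))
        (Primrec.snd.comp Primrec.fst)
    · exact ((Primrec.fst.comp (Primrec.fst.comp Primrec.fst)).pair (hget.comp Primrec.snd
        (Primrec.snd.comp (Primrec.fst.comp Primrec.fst)))).to_comp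
  refine ⟨_, hC.exists, ?_⟩
  rintro ⟨a, n⟩ ω
  rw [Set.mem_preimage, h]
  constructor
  · rintro ⟨z, hz, hSz⟩
    suffices H : ∀ (n : ℕ) (ω : Cantor), IsPrefix z (T^[n] ω) → ∃ l : List (List Bool),
        IsPrefix (l.getD 0 []) ω ∧ l.getD n [] = z ∧
          ∀ i < n, (l.getD i [], l.getD (i + 1) []) ∈ R by
      obtain ⟨l, h0, hn, hl⟩ := H n ω hz
      exact ⟨_, h0, l, hl, rfl, by simpa only [hn] using hSz⟩
    intro n
    induction n with
    | zero => exact fun ω hω => ⟨[z], hω, rfl, fun i hi => absurd hi (Nat.not_lt_zero i)⟩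
    | succ n ih =>
      intro ω hω
      obtain ⟨l, h0, hn, hl⟩ := ih (T ω) hω
      obtain ⟨x, hx, hxR⟩ := ComputableTransformation.exists_prefix hR (hRT ω) h0
      refine ⟨x :: l, hx, hn, fun i hi => ?_⟩
      cases i with
      | zero => exact hxR
      | succ i => exact hl i (by omega)
  · rintro ⟨x, hx, l, hl, h0, hS⟩
    refine ⟨_, ?_, hS⟩
    have H : ∀ i ≤ n, IsPrefix (l.getD i []) (T^[i] ω) := by
      intro i
      induction i with
      | zero =>
        intro _
        have h0 : l.getD 0 [] = x := h0
        rw [h0]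
        exact hx
      | succ i ih =>
        intro hi
        rw [Function.iterate_succ_apply']
        exact (hRT _).1 _ _ (ih (by omega)) (hl i hi)
    exact H n le_rfl

theorem EffOpen.uniformlyEffectivelyOpen {U : ℕ → Set Cantor} (hU : EffOpen U) :
    UniformlyEffectivelyOpen U := by
  obtain ⟨S, hS, h⟩ := hU
  obtain ⟨s, hs, hSs⟩ := rePred_iff_exists_primrecRel.1 hS
  classical
  let e : ℕ → ℕ → Option (List Bool) := fun n i =>
    (decode (α := List Bool × ℕ) i).bind fun p => if s (n, p.1) p.2 then some p.1 else none
  have he : Primrec₂ e := by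
    refine Primrec.option_bind (Primrec.decode.comp Primrec.snd) (Primrec.ite ?_ ?_ ?_)
    · exact hs.comp ((Primrec.fst.comp Primrec.fst).pair (Primrec.fst.comp Primrec.snd))
        (Primrec.snd.comp Primrec.snd)
    · exact Primrec.option_some.comp (Primrec.fst.comp Primrec.snd)
    · exact Primrec.const none
  refine ⟨fun n i => (e n i : Part (List Bool)), he.to_comp.ofOption, fun n => ?_⟩
  ext ω
  simp only [h, hSs, Set.mem_ofPred_eq, Part.mem_ofOption, Option.mem_def]
  constructor
  · rintro ⟨x, hx, t, ht⟩
    exact ⟨encode (x, t), x, by simp [e, ht], hx⟩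
  · rintro ⟨i, x, hx, hω⟩
    obtain ⟨p, -, hp⟩ := Option.bind_eq_some_iff.1 hx
    split_ifs at hp with hs
    obtain rfl := Option.some.inj hp
    exact ⟨_, hω, _, hs⟩

end EffOpen

end AlgorithmicErgodic

namespace AlgorithmicErgodic

/-! ### Effectively open sublevel sets -/

/-- The value of a simple function on an interval `Γ_x`, for `x` long enough. -/
def SimpleCode.evalOn (c : SimpleCode) (x : List Bool) : RatCode :=
  c.foldr (fun p r => if p.1 <+: x then p.2 else r) ((0, 0), 0)

theorem primrec_evalOn : Primrec₂ SimpleCode.evalOn := by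
  refine Primrec.list_foldr (f := fun q : SimpleCode × List Bool => q.1)
    (g := fun _ => (((0, 0), 0) : RatCode))
    (h := fun q p => if p.1.1 <+: q.2 then p.1.2 else p.2) Primrec.fst (Primrec.const _) ?_
  refine Primrec.ite ?_ ?_ ?_
  · exact primrecRel_prefix.comp (Primrec.fst.comp (Primrec.fst.comp Primrec.snd))
      (Primrec.snd.comp Primrec.fst)
  · exact Primrec.snd.comp (Primrec.fst.comp Primrec.snd)
  · exact Primrec.snd.comp Primrec.snd

theorem SimpleCode.eval_eq_evalOn {c : SimpleCode} {x : List Bool} {ω : Cantor}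
    (hc : ∀ p ∈ c, p.1.length ≤ x.length) (hx : IsPrefix x ω) :
    c.eval ω = (c.evalOn x).val := by
  induction c with
  | nil => simp [SimpleCode.eval, SimpleCode.evalOn, RatCode.val]
  | cons p c ih =>
    have h1 : IsPrefix p.1 ω ↔ p.1 <+: x :=
      ⟨fun h => h.prefix_of_length_le hx (hc p (by simp)), fun h => hx.of_prefix h⟩
    have h2 : SimpleCode.evalOn (p :: c) x = if p.1 <+: x then p.2 else SimpleCode.evalOn c x := rfl
    have h3 : SimpleCode.eval (p :: c) ω = if IsPrefix p.1 ω then p.2.val else SimpleCode.eval c ω :=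
      rfl
    rw [h2, h3]
    by_cases h : p.1 <+: x
    · rw [if_pos h, if_pos (h1.2 h)]
    · rw [if_neg h, if_neg (mt h1.1 h)]
      exact ih fun q hq => hc q (by simp [hq])

/-- A prefix of `ω` at least as long as every string in the code determines the value of a simple
function, so a condition on the value becomes a decidable condition on such a prefix. -/
theorem effOpen_exists_eval {B : Type*} [Primcodable B] {h : ℕ → SimpleCode} (hh : Computable h)
    {Q : ℚ → B → Prop} (hQ : PrimrecRel fun (r : RatCode) b => Q r.val b) :
    EffOpen fun b => {ω | ∃ m, Q ((h m).eval ω) b} := by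
  let S : SimpleCode × (B × List Bool) → Prop := fun p =>
    (∀ y ∈ p.1, y.1.length ≤ p.2.2.length) ∧ Q (p.1.evalOn p.2.2).val p.2.1
  have hS : PrimrecPred S := by
    refine PrimrecPred.and ?_ ?_
    · have h1 : PrimrecRel fun (y : List Bool × RatCode) (p : B × List Bool) =>
          y.1.length ≤ p.2.length :=
        Primrec.nat_le.comp (Primrec.list_length.comp (Primrec.fst.comp Primrec.fst))
          (Primrec.list_length.comp (Primrec.snd.comp Primrec.snd))
      exact h1.forall_mem_list
    · exact hQ.comp (primrec_evalOn.comp Primrec.fst (Primrec.snd.comp Primrec.snd))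
        (Primrec.fst.comp Primrec.snd)
  have hS' : REPred fun q : (B × List Bool) × ℕ => S (h q.2, q.1) :=
    hS.rePred.comp ((hh.comp Computable.snd).pair Computable.fst)
  refine ⟨_, hS'.exists, fun b ω => ?_⟩
  constructor
  · rintro ⟨m, hm⟩
    have hlen : ∀ y ∈ h m, y.1.length ≤
        (initSeg ω ((h m).toFinset.sup fun y => y.1.length)).length := by
      intro y hy
      rw [length_initSeg]
      exact Finset.le_sup (f := fun y : List Bool × RatCode => y.1.length) (List.mem_toFinset.2 hy)
    refine ⟨_, isPrefix_initSeg ω _, m, hlen, ?_⟩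
    rwa [SimpleCode.eval_eq_evalOn hlen (isPrefix_initSeg ω _)] at hm
  · rintro ⟨x, hx, m, hlen, hm⟩
    refine ⟨m, ?_⟩
    rwa [SimpleCode.eval_eq_evalOn hlen hx]

/-- The sublevel sets of `g` at rational levels are uniformly effectively open. -/
def EffUpper (g : Cantor → ℝ) : Prop :=
  EffOpen fun p : ℕ × ℕ => {ω | g ω < (p.1 : ℝ) / ((p.2 : ℝ) + 1)}

theorem primrec_mul_succ {A : Type*} [Primcodable A] {a d : A → ℕ} (ha : Primrec a)
    (hd : Primrec d) : Primrec fun x => a x * (d x + 1) :=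
  Primrec.nat_mul.comp ha (Primrec.succ.comp hd)

theorem RatCode.val_lt_iff (r : RatCode) (k d : ℕ) :
    r.val < (k : ℚ) / ((d : ℚ) + 1) ↔ r.1.1 * (d + 1) < k * (r.2 + 1) + r.1.2 * (d + 1) := by
  rw [RatCode.val, div_lt_div_iff₀ (by positivity) (by positivity), ← @Nat.cast_lt ℚ]
  push_cast
  constructor <;> intro h <;> linarith

theorem RatCode.lt_val_iff (r : RatCode) (C k d : ℕ) :
    (C : ℚ) - (k : ℚ) / ((d : ℚ) + 1) < r.val ↔
      C * (d + 1) * (r.2 + 1) + r.1.2 * (d + 1) < k * (r.2 + 1) + r.1.1 * (d + 1) := by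
  have h1 : (0 : ℚ) < (d : ℚ) + 1 := by positivity
  rw [RatCode.val, sub_lt_iff_lt_add, div_add_div _ _ (by positivity) h1.ne',
    lt_div_iff₀ (by positivity), ← @Nat.cast_lt ℚ]
  push_cast
  constructor <;> intro h <;> linarith

/-- Since the approximations decrease to `f`, `f` lies below a level exactly when some approximation
does. -/
theorem UpperSemicomputableFun.effUpper {f : Cantor → ℝ} (hf : UpperSemicomputableFun f) :
    EffUpper f := by
  obtain ⟨h, hh, hanti, hlim⟩ := hf
  have hQ : PrimrecRel fun (r : RatCode) (p : ℕ × ℕ) => r.val < (p.1 : ℚ) / ((p.2 : ℚ) + 1) := by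
    refine PrimrecRel.of_eq (r := fun (r : RatCode) (p : ℕ × ℕ) =>
      r.1.1 * (p.2 + 1) < p.1 * (r.2 + 1) + r.1.2 * (p.2 + 1)) ?_
      fun r p => (RatCode.val_lt_iff r p.1 p.2).symm
    have a1 : Primrec fun z : RatCode × (ℕ × ℕ) => z.1.1.1 :=
      Primrec.fst.comp (Primrec.fst.comp Primrec.fst)
    have a2 : Primrec fun z : RatCode × (ℕ × ℕ) => z.1.1.2 :=
      Primrec.snd.comp (Primrec.fst.comp Primrec.fst)
    have a3 : Primrec fun z : RatCode × (ℕ × ℕ) => z.1.2 := Primrec.snd.comp Primrec.fst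
    have b1 : Primrec fun z : RatCode × (ℕ × ℕ) => z.2.1 := Primrec.fst.comp Primrec.snd
    have b2 : Primrec fun z : RatCode × (ℕ × ℕ) => z.2.2 := Primrec.snd.comp Primrec.snd
    exact Primrec.nat_lt.comp (primrec_mul_succ a1 b2)
      (Primrec.nat_add.comp (primrec_mul_succ b1 a3) (primrec_mul_succ a2 b2))
  refine (effOpen_exists_eval (Q := fun r (p : ℕ × ℕ) =>
    r < (p.1 : ℚ) / ((p.2 : ℚ) + 1)) hh hQ).of_eq fun p ω => ?_
  have hle : ∀ m, f ω ≤ ((h m).eval ω : ℝ) := fun m =>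
    (antitone_nat_of_succ_le (f := fun n => (((h n).eval ω : ℚ) : ℝ))
      fun n => by exact_mod_cast hanti n ω).le_of_tendsto (hlim ω) m
  constructor
  · rintro ⟨m, hm⟩
    refine (hle m).trans_lt ?_
    have := (Rat.cast_lt (K := ℝ)).2 hm
    push_cast at this
    exact this
  · intro hω
    obtain ⟨m, hm⟩ := ((hlim ω).eventually (gt_mem_nhds hω)).exists
    refine ⟨m, ?_⟩
    rw [← Rat.cast_lt (K := ℝ)]
    push_cast
    exact hm

theorem LowerSemicomputableFun.effUpper_sub {f : Cantor → ℝ} (hf : LowerSemicomputableFun f)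
    (C : ℕ) : EffUpper fun ω => C - f ω := by
  obtain ⟨h, hh, hmono, hlim⟩ := hf
  have hQ : PrimrecRel fun (r : RatCode) (p : ℕ × ℕ) =>
      (C : ℚ) - (p.1 : ℚ) / ((p.2 : ℚ) + 1) < r.val := by
    refine PrimrecRel.of_eq (r := fun (r : RatCode) (p : ℕ × ℕ) =>
      C * (p.2 + 1) * (r.2 + 1) + r.1.2 * (p.2 + 1) < p.1 * (r.2 + 1) + r.1.1 * (p.2 + 1)) ?_
      fun r p => (RatCode.lt_val_iff r C p.1 p.2).symm
    have a1 : Primrec fun z : RatCode × (ℕ × ℕ) => z.1.1.1 :=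
      Primrec.fst.comp (Primrec.fst.comp Primrec.fst)
    have a2 : Primrec fun z : RatCode × (ℕ × ℕ) => z.1.1.2 :=
      Primrec.snd.comp (Primrec.fst.comp Primrec.fst)
    have a3 : Primrec fun z : RatCode × (ℕ × ℕ) => z.1.2 := Primrec.snd.comp Primrec.fst
    have b1 : Primrec fun z : RatCode × (ℕ × ℕ) => z.2.1 := Primrec.fst.comp Primrec.snd
    have b2 : Primrec fun z : RatCode × (ℕ × ℕ) => z.2.2 := Primrec.snd.comp Primrec.snd
    exact Primrec.nat_lt.comp
      (Primrec.nat_add.comp (primrec_mul_succ (primrec_mul_succ (Primrec.const C) b2) a3)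
        (primrec_mul_succ a2 b2))
      (Primrec.nat_add.comp (primrec_mul_succ b1 a3) (primrec_mul_succ a1 b2))
  refine (effOpen_exists_eval (Q := fun r (p : ℕ × ℕ) =>
    (C : ℚ) - (p.1 : ℚ) / ((p.2 : ℚ) + 1) < r) hh hQ).of_eq fun p ω => ?_
  have hle : ∀ m, ((h m).eval ω : ℝ) ≤ f ω := fun m =>
    (monotone_nat_of_le_succ (f := fun n => (((h n).eval ω : ℚ) : ℝ))
      fun n => by exact_mod_cast hmono n ω).ge_of_tendsto (hlim ω) m
  constructor
  · rintro ⟨m, hm⟩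
    have := (Rat.cast_lt (K := ℝ)).2 hm
    push_cast at this
    have h2 := hle m
    change (C : ℝ) - f ω < _
    linarith
  · intro hω
    have hω : (C : ℝ) - f ω < (p.1 : ℝ) / ((p.2 : ℝ) + 1) := hω
    obtain ⟨m, hm⟩ := ((hlim ω).eventually (lt_mem_nhds (sub_lt_comm.1 hω))).exists
    refine ⟨m, ?_⟩
    rw [← Rat.cast_lt (K := ℝ)]
    push_cast
    exact hm

theorem primrec_list_sum : Primrec (List.sum : List ℕ → ℕ) := by
  refine (Primrec.list_foldr (f := fun l : List ℕ => l) (g := fun _ => 0)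
    (h := fun _ p => p.1 + p.2) Primrec.id (Primrec.const 0) ?_).of_eq fun l => rfl
  exact Primrec.nat_add.comp (Primrec.fst.comp Primrec.snd) (Primrec.snd.comp Primrec.snd)

theorem sum_range_getD (l : List ℕ) : ∑ i ∈ Finset.range l.length, l.getD i 0 = l.sum := by
  induction l with
  | nil => simp
  | cons a l ih => rw [List.length_cons, Finset.sum_range_succ', List.sum_cons, ← ih, add_comm]; simp

/-- The sublevel sets of the Birkhoff sums of a nonnegative function are effectively open,
uniformly in the number of summands. -/
theorem EffUpper.effOpen_birkhoffSum {g : Cantor → ℝ} (hg : EffUpper g) (hg0 : ∀ ω, 0 ≤ g ω)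
    {T : Cantor → Cantor} (hT : ComputableTransformation T) :
    EffOpen fun q : ℕ × (ℕ × ℕ) =>
      {ω | birkhoffSum T g q.1 ω < (q.2.1 : ℝ) / ((q.2.2 : ℝ) + 1)} := by
  -- A pair `(D, l)` proposes the strict upper bound `l[i] / (D + 1)` for the `i`-th summand. The
  -- sum is below the level exactly when some such pair is correct and has its total below the
  -- level.
  have h1 : EffOpen fun x : (ℕ × List ℕ) × ℕ =>
      {ω | g (T^[x.2] ω) < ((x.1.2.getD x.2 0 : ℕ) : ℝ) / ((x.1.1 : ℝ) + 1)} :=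
    (EffOpen.preimage_iterate hg hT).comp
      (g := fun x : (ℕ × List ℕ) × ℕ => ((x.1.2.getD x.2 0, x.1.1), x.2))
      (((((Primrec.list_getD 0).comp (Primrec.snd.comp Primrec.fst) Primrec.snd).pair
        (Primrec.fst.comp Primrec.fst)).pair Primrec.snd).to_comp)
  have h2 : EffOpen fun x : (ℕ × (ℕ × ℕ)) × (ℕ × List ℕ) =>
      {ω | ∀ i < x.1.1, ω ∈ {ω | g (T^[i] ω) < ((x.2.2.getD i 0 : ℕ) : ℝ) / ((x.2.1 : ℝ) + 1)}} :=
    h1.iInter_lt.comp (g := fun x : (ℕ × (ℕ × ℕ)) × (ℕ × List ℕ) => (x.2, x.1.1))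
      (Primrec.snd.pair (Primrec.fst.comp Primrec.fst)).to_comp
  have h3 : EffOpen fun x : (ℕ × (ℕ × ℕ)) × (ℕ × List ℕ) => {_ω : Cantor | x.2.2.length = x.1.1 ∧
      x.2.2.sum * (x.1.2.2 + 1) < x.1.2.1 * (x.2.1 + 1)} := by
    refine EffOpen.of_rePred (PrimrecPred.rePred (PrimrecPred.and ?_ ?_))
    · exact Primrec.eq.comp (Primrec.list_length.comp (Primrec.snd.comp Primrec.snd))
        (Primrec.fst.comp Primrec.fst)
    · exact Primrec.nat_lt.comp
        (primrec_mul_succ (primrec_list_sum.comp (Primrec.snd.comp Primrec.snd))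
          (Primrec.snd.comp (Primrec.snd.comp Primrec.fst)))
        (primrec_mul_succ (Primrec.fst.comp (Primrec.snd.comp Primrec.fst))
          (Primrec.fst.comp Primrec.snd))
  refine (h2.inter h3).iUnion.of_eq ?_
  rintro ⟨n, k, d⟩ ω
  simp only [Set.mem_iUnion, Set.mem_inter_iff, Set.mem_ofPred_eq, Prod.exists]
  have hd : (0 : ℝ) < (d : ℝ) + 1 := by positivity
  constructor
  · rintro ⟨D, l, hl, hlen, hsum⟩
    have hD : (0 : ℝ) < (D : ℝ) + 1 := by positivity
    have hS : birkhoffSum T g n ω ≤ (l.sum : ℝ) / ((D : ℝ) + 1) := by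
      rw [← sum_range_getD, hlen, Nat.cast_sum, Finset.sum_div]
      exact Finset.sum_le_sum fun i hi => (hl i (Finset.mem_range.1 hi)).le
    refine hS.trans_lt ?_
    rw [div_lt_div_iff₀ hD hd]
    exact_mod_cast hsum
  · intro hω
    -- Each rounding upwards costs at most `1 / (D + 1)`, so the `n` roundings together stay within
    -- the gap between the sum and the level.
    obtain ⟨D, hD⟩ := exists_nat_gt ((n : ℝ) / ((k : ℝ) / ((d : ℝ) + 1) - birkhoffSum T g n ω))
    have hD1 : (0 : ℝ) < (D : ℝ) + 1 := by positivity
    have hlt : ∀ i, g (T^[i] ω) * ((D : ℝ) + 1) < ((⌊g (T^[i] ω) * ((D : ℝ) + 1)⌋₊ + 1 : ℕ) : ℝ) :=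
      fun i => by push_cast; exact Nat.lt_floor_add_one _
    refine ⟨D, (List.range n).map fun i => ⌊g (T^[i] ω) * ((D : ℝ) + 1)⌋₊ + 1, fun i hi => ?_,
      by simp, ?_⟩
    · rw [lt_div_iff₀ hD1]
      have : ((List.range n).map fun i => ⌊g (T^[i] ω) * ((D : ℝ) + 1)⌋₊ + 1).getD i 0 =
          ⌊g (T^[i] ω) * ((D : ℝ) + 1)⌋₊ + 1 := by
        simp [List.getD_eq_getElem?_getD, hi]
      rw [this]
      exact hlt i
    · have hs : (((List.range n).map fun i => ⌊g (T^[i] ω) * ((D : ℝ) + 1)⌋₊ + 1).sum : ℝ) ≤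
          birkhoffSum T g n ω * ((D : ℝ) + 1) + n := by
        rw [show ((List.range n).map fun i => ⌊g (T^[i] ω) * ((D : ℝ) + 1)⌋₊ + 1).sum =
          ∑ i ∈ Finset.range n, (⌊g (T^[i] ω) * ((D : ℝ) + 1)⌋₊ + 1) from rfl, Nat.cast_sum, birkhoffSum, Finset.sum_mul]
        have : (n : ℝ) = ∑ i ∈ Finset.range n, (1 : ℝ) := by simp
        rw [this, ← Finset.sum_add_distrib]
        refine Finset.sum_le_sum fun i _ => ?_
        push_cast
        gcongr
        exact Nat.floor_le (mul_nonneg (hg0 _) hD1.le)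
      rw [div_lt_iff₀ (sub_pos.2 hω)] at hD
      rw [← @Nat.cast_lt ℝ, Nat.cast_mul, Nat.cast_mul, Nat.cast_add_one, Nat.cast_add_one]
      have hk : (k : ℝ) = (k : ℝ) / ((d : ℝ) + 1) * ((d : ℝ) + 1) := by field_simp
      have h0 := sub_pos.2 hω
      calc _ ≤ (birkhoffSum T g n ω * ((D : ℝ) + 1) + n) * ((d : ℝ) + 1) := by
              gcongr
        _ < ((k : ℝ) / ((d : ℝ) + 1) * ((D : ℝ) + 1)) * ((d : ℝ) + 1) := by
              gcongr
              nlinarith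
        _ = _ := by rw [mul_right_comm, ← hk]

end AlgorithmicErgodic

namespace AlgorithmicErgodic

/-! ### The upcrossing inequality -/

/-- `l` is a list of disjoint integer intervals `(u, v]`, in increasing order, inside `(k, n]`. -/
def Schedule (n : ℕ) : ℕ → List (ℕ × ℕ) → Prop
  | _, [] => True
  | k, p :: l => k ≤ p.1 ∧ p.1 < p.2 ∧ p.2 ≤ n ∧ Schedule n p.2 l

/-- The profit made by buying at price `a u` and selling at price `b v` for each `(u, v)` in `l`. -/
def profit (a b : ℕ → ℝ) (l : List (ℕ × ℕ)) : ℝ := (l.map fun p => b p.2 - a p.1).sum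

@[simp] theorem profit_nil (a b : ℕ → ℝ) : profit a b [] = 0 := rfl

@[simp] theorem profit_cons (a b : ℕ → ℝ) (p : ℕ × ℕ) (l : List (ℕ × ℕ)) :
    profit a b (p :: l) = b p.2 - a p.1 + profit a b l := by simp [profit]

theorem Schedule.mono {n m k j : ℕ} (hn : n ≤ m) (hk : j ≤ k) {l : List (ℕ × ℕ)}
    (h : Schedule n k l) : Schedule m j l := by
  induction l generalizing k j with
  | nil => trivial
  | cons p l ih => exact ⟨hk.trans h.1, h.2.1, h.2.2.1.trans hn, ih le_rfl h.2.2.2⟩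

/-- If there are more upcrossings than intervals in a schedule, then an interval can be added to the
schedule without diminishing the profit. -/
theorem Schedule.exists_insert {a b : ℕ → ℝ} {n k : ℕ} {l s : List (ℕ × ℕ)}
    (hl : Schedule n k l) (hs : Schedule n k s) (hup : ∀ p ∈ s, a p.1 < 0 ∧ 0 < b p.2)
    (hlen : l.length < s.length) :
    ∃ t, Schedule n k t ∧ t.length = l.length + 1 ∧ profit a b l ≤ profit a b t := by
  induction l generalizing k s with
  | nil =>
    match s, hlen with
    | p :: s, _ =>
      refine ⟨[p], ⟨hs.1, hs.2.1, hs.2.2.1, trivial⟩, rfl, ?_⟩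
      have := hup p (by simp)
      simp only [profit_nil, profit_cons]
      linarith
  | cons p l ih =>
    match s, hlen with
    | [q], h => simp at h
    | q :: r :: s, h =>
      have hq := hup q (by simp)
      have hr := hup r (by simp)
      -- If the upcrossing `q` ends before the trade `p` begins, it is added in front. Otherwise, if
      -- the next upcrossing `r` begins before `p` ends, `p` is cut into two trades by selling at
      -- `q.2` and buying back at `r.1`, which gains `b q.2 - a r.1 > 0`. Otherwise `p` ends before
      -- `r` begins; discarding both `p` and `q` preserves the difference in number.
      by_cases h1 : q.2 ≤ p.1
      · refine ⟨q :: p :: l, ⟨hs.1, hs.2.1, hs.2.2.1, h1, hl.2⟩, rfl, ?_⟩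
        simp only [profit_cons]
        linarith
      · rw [not_le] at h1
        by_cases h2 : r.1 < p.2
        · refine ⟨(p.1, q.2) :: (r.1, p.2) :: l,
            ⟨hl.1, h1, hs.2.2.1, hs.2.2.2.1, h2, hl.2.2⟩, rfl, ?_⟩
          simp only [profit_cons]
          linarith
        · rw [not_lt] at h2
          obtain ⟨t, ht, htl, htp⟩ := ih (k := p.2) (s := r :: s) hl.2.2.2
            ⟨h2, hs.2.2.2.2⟩ (fun q' hq' => hup q' (List.mem_cons_of_mem _ hq'))
            (by simpa using h)
          refine ⟨p :: t, ⟨hl.1, hl.2.1, hl.2.2.1, ht⟩, by simp [htl], ?_⟩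
          simp only [profit_cons]
          linarith

/-- Repeated insertion. On the upcrossing set this allows the gain per trade to be counted `N`
times. -/
theorem Schedule.exists_length_eq {a b : ℕ → ℝ} {n k : ℕ} {l s : List (ℕ × ℕ)}
    (hl : Schedule n k l) (hs : Schedule n k s) (hup : ∀ p ∈ s, a p.1 < 0 ∧ 0 < b p.2)
    (hlen : l.length ≤ s.length) :
    ∃ t, Schedule n k t ∧ t.length = s.length ∧ profit a b l ≤ profit a b t := by
  obtain ⟨j, hj⟩ := Nat.exists_eq_add_of_le hlen
  induction j generalizing l with
  | zero => exact ⟨l, hl, hj.symm, le_rfl⟩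
  | succ j ih =>
    obtain ⟨t, ht, htl, htp⟩ := hl.exists_insert hs hup (by omega)
    obtain ⟨t', ht', htl', htp'⟩ := ih ht (by omega) (by omega)
    exact ⟨t', ht', htl', htp.trans htp'⟩

/-- The schedule moved one unit of time to the left. -/
def shiftSchedule (l : List (ℕ × ℕ)) : List (ℕ × ℕ) := l.map fun p => (p.1 - 1, p.2 - 1)

@[simp] theorem length_shiftSchedule (l : List (ℕ × ℕ)) : (shiftSchedule l).length = l.length := by
  simp [shiftSchedule]

theorem Schedule.shift {n k : ℕ} {l : List (ℕ × ℕ)} (h : Schedule n (k + 1) l) :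
    Schedule n k (shiftSchedule l) := by
  induction l generalizing k with
  | nil => trivial
  | cons p l ih =>
    obtain ⟨h1, h2, h3, h4⟩ := h
    refine ⟨by dsimp only; omega, by dsimp only; omega, by dsimp only; omega, ih ?_⟩
    dsimp only
    rwa [show p.2 - 1 + 1 = p.2 by omega]

/-- The common term `y` cancels between each purchase and its sale, and every sale loses `δ`. All
times are at least 1, so the truncated subtraction in `shiftSchedule` is exact. -/
theorem Schedule.profit_shift {a b a' b' : ℕ → ℝ} {y δ : ℝ} (ha : ∀ k, a (k + 1) = y + a' k)
    (hb : ∀ k, b (k + 1) = y - δ + b' k) {n k : ℕ} {l : List (ℕ × ℕ)}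
    (h : Schedule n (k + 1) l) :
    profit a b l = profit a' b' (shiftSchedule l) - l.length * δ := by
  induction l generalizing k with
  | nil => simp [shiftSchedule]
  | cons p l ih =>
    obtain ⟨⟨u, v⟩, h1, h2, h3, h4⟩ : ∃ q : ℕ × ℕ, p = (q.1 + 1, q.2 + 1) ∧ q.1 < q.2 ∧
        q.2 + 1 ≤ n ∧ Schedule n (q.2 + 1) l := by
      obtain ⟨h1, h2, h3, h4⟩ := h
      refine ⟨(p.1 - 1, p.2 - 1), ?_, ?_, ?_, ?_⟩
      · ext <;> dsimp only <;> omega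
      · dsimp only; omega
      · dsimp only; omega
      · dsimp only
        rwa [show p.2 - 1 + 1 = p.2 by omega]
    subst h1
    have := ih h4
    simp only [shiftSchedule, List.map_cons, profit_cons, List.length_cons] at this ⊢
    rw [this, ha, hb]
    push_cast
    ring

/-- Only a first trade that buys at time 0 cannot be shifted. Its purchase costs 0 both before and
after the move, so the `y` in its sale is left uncancelled, and this is at most `c`. -/
theorem Schedule.exists_shift {a b a' b' : ℕ → ℝ} {y δ c : ℝ} (ha0 : a 0 = 0) (ha0' : a' 0 = 0)
    (hb0' : b' 0 = 0) (ha : ∀ k, a (k + 1) = y + a' k) (hb : ∀ k, b (k + 1) = y - δ + b' k)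
    (hc : 0 ≤ c) (hy : y ≤ c) {n : ℕ} {l : List (ℕ × ℕ)} (h : Schedule n 0 l) :
    ∃ t, Schedule n 0 t ∧ t.length ≤ l.length ∧
      profit a b l ≤ profit a' b' t - l.length * δ + c := by
  match l, h with
  | [], _ => exact ⟨[], trivial, le_rfl, by simpa using hc⟩
  | (u + 1, v) :: l, h =>
    have h' : Schedule n (0 + 1) ((u + 1, v) :: l) := ⟨by simp, h.2⟩
    refine ⟨_, h'.shift, by simp, ?_⟩
    rw [h'.profit_shift ha hb]
    linarith
  | (0, v + 1) :: l, h =>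
    obtain ⟨-, h2, h3, h4⟩ := h
    have h4 : Schedule n (v + 1) l := h4
    have key : profit a b ((0, v + 1) :: l) = y - δ + b' v + (profit a' b' (shiftSchedule l) -
        l.length * δ) := by
      rw [profit_cons, h4.profit_shift ha hb, hb, ha0]
      ring
    rw [key, List.length_cons]
    push_cast
    -- The trade `(0, 1)` would shift to the empty interval `(0, 0)`, so it is dropped. This is why
    -- the new schedule may be shorter, while `δ` is still counted for every old trade.
    rcases Nat.eq_zero_or_pos v with hv | hv
    · subst hv
      refine ⟨shiftSchedule l, h4.shift, by simp, ?_⟩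
      rw [hb0']
      linarith
    · refine ⟨(0, v) :: shiftSchedule l, ⟨le_rfl, hv, by omega, h4.shift⟩, by simp, ?_⟩
      rw [profit_cons, ha0']
      dsimp only
      linarith

theorem Schedule.abs_profit_le {a b : ℕ → ℝ} {M : ℝ} {n k : ℕ} (ha : ∀ j ≤ n, |a j| ≤ M)
    (hb : ∀ j ≤ n, |b j| ≤ M) {l : List (ℕ × ℕ)} (h : Schedule n k l) :
    |profit a b l| ≤ l.length * (2 * M) := by
  induction l generalizing k with
  | nil => simp
  | cons p l ih =>
    obtain ⟨h1, h2, h3, h4⟩ := h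
    have e1 := abs_le.1 (ha p.1 (by omega))
    have e2 := abs_le.1 (hb p.2 h3)
    have e3 := abs_le.1 (ih h4)
    rw [profit_cons, List.length_cons, abs_le]
    push_cast
    constructor <;> linarith

open MeasureTheory

/-! ### Bishop's inequality for measure-preserving maps -/

section Upcrossing

variable {X : Type*} {T : X → X} {f : X → ℝ}

/-- The Birkhoff sums of `f - α`. -/
noncomputable def centeredSum (T : X → X) (f : X → ℝ) (α : ℝ) (ω : X) (k : ℕ) : ℝ :=
  birkhoffSum T f k ω - k * α

theorem centeredSum_zero (α : ℝ) (ω : X) : centeredSum T f α ω 0 = 0 := by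
  simp [centeredSum]

theorem centeredSum_succ (α : ℝ) (ω : X) (k : ℕ) :
    centeredSum T f α ω (k + 1) = f ω - α + centeredSum T f α (T ω) k := by
  simp only [centeredSum, birkhoffSum_succ', Nat.cast_add_one]
  ring

theorem abs_centeredSum_le {C : ℝ} (hC : ∀ ω, |f ω| ≤ C) (α : ℝ) (ω : X) (k : ℕ) :
    |centeredSum T f α ω k| ≤ k * (C + |α|) := by
  induction k generalizing ω with
  | zero => simp [centeredSum_zero]
  | succ k ih =>
    rw [centeredSum_succ]
    have h1 := abs_add_le (f ω - α) (centeredSum T f α (T ω) k)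
    have h2 := abs_sub (f ω) α
    have h3 := hC ω
    have h4 := ih (T ω)
    push_cast
    linarith

/-- The set of points whose Birkhoff averages make `N` upcrossings from below `α` to above `β`
up to time `n`. -/
def upcrossingSet (T : X → X) (f : X → ℝ) (α β : ℝ) (N n : ℕ) : Set X :=
  {ω | ∃ s, Schedule n 0 s ∧ s.length = N ∧
    ∀ p ∈ s, centeredSum T f α ω p.1 < 0 ∧ 0 < centeredSum T f β ω p.2}

/-- The largest profit of a schedule with at most `N` intervals up to time `n`. -/
noncomputable def maxProfit (T : X → X) (f : X → ℝ) (α β : ℝ) (N n : ℕ) (ω : X) : ℝ :=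
  ⨆ s : {l : List (ℕ × ℕ) // Schedule n 0 l ∧ l.length ≤ N},
    profit (centeredSum T f α ω) (centeredSum T f β ω) s.1

/-- Uniformity in `ω` makes the supremum `maxProfit` genuine and, later, integrable. -/
theorem exists_abs_profit_le {C : ℝ} (hC : ∀ ω, |f ω| ≤ C) (α β : ℝ) (N n : ℕ) :
    ∃ M, ∀ (ω : X) (l : List (ℕ × ℕ)), Schedule n 0 l → l.length ≤ N →
      |profit (centeredSum T f α ω) (centeredSum T f β ω) l| ≤ M := by
  refine ⟨N * (2 * (n * (C + |α| + |β|))), fun ω l hl hN => ?_⟩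
  have hC0 : 0 ≤ C := (abs_nonneg _).trans (hC ω)
  have h1 := abs_nonneg α
  have h2 := abs_nonneg β
  refine (hl.abs_profit_le (M := n * (C + |α| + |β|)) (fun j hj => ?_) (fun j hj => ?_)).trans ?_
  · refine (abs_centeredSum_le hC α ω j).trans ?_
    exact mul_le_mul (Nat.cast_le.2 hj) (by linarith) (by positivity) (by positivity)
  · refine (abs_centeredSum_le hC β ω j).trans ?_
    exact mul_le_mul (Nat.cast_le.2 hj) (by linarith) (by positivity) (by positivity)
  · gcongr

/-- Any schedule for `ω` moves to one for `T ω` with a gain of `β - α` per trade and a loss of at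
most `c`. On the upcrossing set it is first filled up to exactly `N` trades. -/
theorem maxProfit_add_indicator_le {C c : ℝ} (hC : ∀ ω, |f ω| ≤ C) {α β : ℝ} (hαβ : α ≤ β)
    (hc : 0 ≤ c) (hfc : ∀ ω, f ω - α ≤ c) (N n : ℕ) (ω : X) :
    maxProfit T f α β N n ω + (upcrossingSet T f α β N n).indicator (fun _ => N * (β - α)) ω ≤
      maxProfit T f α β N n (T ω) + c := by
  obtain ⟨M, hM⟩ := exists_abs_profit_le (T := T) hC α β N n
  have hle : ∀ (l : List (ℕ × ℕ)), Schedule n 0 l → l.length ≤ N →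
      profit (centeredSum T f α (T ω)) (centeredSum T f β (T ω)) l ≤ maxProfit T f α β N n (T ω) := by
    intro l hl hN
    refine le_ciSup (f := fun s : {l : List (ℕ × ℕ) // Schedule n 0 l ∧ l.length ≤ N} =>
      profit (centeredSum T f α (T ω)) (centeredSum T f β (T ω)) s.1) ⟨M, ?_⟩ ⟨l, hl, hN⟩
    rintro _ ⟨s, rfl⟩
    exact (le_abs_self _).trans (hM _ _ s.2.1 s.2.2)
  have hstep : ∀ l : List (ℕ × ℕ), Schedule n 0 l → l.length ≤ N →
      profit (centeredSum T f α ω) (centeredSum T f β ω) l + l.length * (β - α) ≤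
        maxProfit T f α β N n (T ω) + c := by
    intro l hl hN
    obtain ⟨t, ht, htl, htp⟩ := hl.exists_shift (a := centeredSum T f α ω)
      (b := centeredSum T f β ω) (y := f ω - α) (δ := β - α) (centeredSum_zero α ω)
      (centeredSum_zero α (T ω)) (centeredSum_zero β (T ω)) (centeredSum_succ α ω)
      (fun k => by rw [centeredSum_succ]; ring) hc (hfc ω)
    have := hle t ht (htl.trans hN)
    linarith
  rw [← le_sub_iff_add_le]
  have : Nonempty {l : List (ℕ × ℕ) // Schedule n 0 l ∧ l.length ≤ N} :=
    ⟨⟨[], trivial, Nat.zero_le _⟩⟩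
  refine ciSup_le fun s => ?_
  rw [le_sub_iff_add_le]
  by_cases hω : ω ∈ upcrossingSet T f α β N n
  · rw [Set.indicator_of_mem hω]
    obtain ⟨q, hq, hqN, hup⟩ := hω
    obtain ⟨t, ht, htl, htp⟩ := s.2.1.exists_length_eq hq hup (hqN ▸ s.2.2)
    have := hstep t ht (by omega)
    rw [htl, hqN] at this
    linarith
  · rw [Set.indicator_of_notMem hω]
    have := hstep s.1 s.2.1 s.2.2
    have h2 : 0 ≤ (s.1.length : ℝ) * (β - α) := mul_nonneg (Nat.cast_nonneg _) (sub_nonneg.2 hαβ)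
    linarith

variable [MeasurableSpace X] {μ : Measure X} [IsProbabilityMeasure μ]

theorem measurable_centeredSum (hT : Measurable T) (hf : Measurable f) (α : ℝ) (k : ℕ) :
    Measurable fun ω => centeredSum T f α ω k := by
  unfold centeredSum birkhoffSum
  have : ∀ i, Measurable fun ω => f (T^[i] ω) := fun i => hf.comp (hT.iterate i)
  fun_prop

theorem measurable_profit (hT : Measurable T) (hf : Measurable f) (α β : ℝ) (l : List (ℕ × ℕ)) :
    Measurable fun ω => profit (centeredSum T f α ω) (centeredSum T f β ω) l := by
  induction l with
  | nil => simp
  | cons p l ih =>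
    simp only [profit_cons]
    exact ((measurable_centeredSum hT hf β p.2).sub (measurable_centeredSum hT hf α p.1)).add ih

theorem measurableSet_upcrossingSet (hT : Measurable T) (hf : Measurable f) (α β : ℝ) (N n : ℕ) :
    MeasurableSet (upcrossingSet T f α β N n) := by
  have : upcrossingSet T f α β N n = ⋃ s : List (ℕ × ℕ), ⋃ _ : Schedule n 0 s ∧ s.length = N,
      ⋂ p ∈ s, {ω | centeredSum T f α ω p.1 < 0} ∩ {ω | 0 < centeredSum T f β ω p.2} := by
    ext ω
    simp [upcrossingSet, and_assoc]
  rw [this]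
  refine MeasurableSet.iUnion fun s => MeasurableSet.iUnion fun _ => ?_
  refine MeasurableSet.biInter (Set.to_countable {p | p ∈ s}) fun p _ => ?_
  exact (measurableSet_lt (measurable_centeredSum hT hf α _) measurable_const).inter
    (measurableSet_lt measurable_const (measurable_centeredSum hT hf β _))

/-- Bishop's upcrossing inequality for the Birkhoff averages of a bounded function. -/
theorem mul_measureReal_upcrossingSet_le (hT : MeasurePreserving T μ μ) (hf : Measurable f)
    {C c : ℝ} (hC : ∀ ω, |f ω| ≤ C) {α β : ℝ} (hαβ : α ≤ β) (hc : 0 ≤ c)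
    (hfc : ∀ ω, f ω - α ≤ c) (N n : ℕ) :
    N * (β - α) * μ.real (upcrossingSet T f α β N n) ≤ c := by
  set E := upcrossingSet T f α β N n with hE
  set m := maxProfit T f α β N n with hm
  have hEm : MeasurableSet E := measurableSet_upcrossingSet hT.measurable hf α β N n
  obtain ⟨M, hM⟩ := exists_abs_profit_le (T := T) hC α β N n
  have : Nonempty {l : List (ℕ × ℕ) // Schedule n 0 l ∧ l.length ≤ N} :=
    ⟨⟨[], trivial, Nat.zero_le _⟩⟩
  have hbdd : ∀ ω, BddAbove (Set.range fun s : {l : List (ℕ × ℕ) // Schedule n 0 l ∧ l.length ≤ N} =>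
      profit (centeredSum T f α ω) (centeredSum T f β ω) s.1) := by
    rintro ω
    refine ⟨M, ?_⟩
    rintro _ ⟨s, rfl⟩
    exact (le_abs_self _).trans (hM _ _ s.2.1 s.2.2)
  have hmm : Measurable m :=
    Measurable.iSup fun s => measurable_profit hT.measurable hf α β s.1
  have hmi : Integrable m μ := by
    refine Integrable.of_bound hmm.aestronglyMeasurable M (Filter.Eventually.of_forall fun ω => ?_)
    rw [Real.norm_eq_abs, abs_le]
    constructor
    · exact (abs_le.1 (hM ω [] trivial (Nat.zero_le _))).1.trans
        (le_ciSup (hbdd ω) ⟨[], trivial, Nat.zero_le _⟩)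
    · exact ciSup_le fun s => (le_abs_self _).trans (hM _ _ s.2.1 s.2.2)
  have hmT : Integrable (fun ω => m (T ω)) μ := hT.integrable_comp_of_integrable hmi
  have hint : ∫ ω, m (T ω) ∂μ = ∫ ω, m ω ∂μ := by
    conv_rhs => rw [← hT.map_eq]
    rw [integral_map hT.measurable.aemeasurable hmm.aestronglyMeasurable]
  have hind : Integrable (E.indicator fun _ => (N : ℝ) * (β - α)) μ :=
    (integrable_const _).indicator hEm
  -- By invariance of `μ` the integrals of `m` and `m ∘ T` agree and cancel, leaving only the
  -- indicator and `c`.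
  have := integral_mono (hmi.add hind) (hmT.add (integrable_const c))
    fun ω => maxProfit_add_indicator_le hC hαβ hc hfc N n ω
  simp only [Pi.add_apply] at this
  rw [integral_add hmi hind, integral_add hmT (integrable_const c), hint,
    integral_indicator_const _ hEm] at this
  simp only [integral_const, probReal_univ, smul_eq_mul, one_mul] at this
  linarith

/-- The measure of the set of points with `N` upcrossings at any time. -/
theorem measure_iUnion_upcrossingSet_le (hT : MeasurePreserving T μ μ) (hf : Measurable f)
    {C c : ℝ} (hC : ∀ ω, |f ω| ≤ C) {α β : ℝ} (hαβ : α < β) (hc : 0 ≤ c)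
    (hfc : ∀ ω, f ω - α ≤ c) {N : ℕ} (hN : 0 < N) :
    μ (⋃ n, upcrossingSet T f α β N n) ≤ ENNReal.ofReal (c / (N * (β - α))) := by
  have hmono : Monotone fun n => upcrossingSet T f α β N n :=
    fun n m hnm ω ⟨s, hs, h⟩ => ⟨s, hs.mono hnm le_rfl, h⟩
  refine le_of_tendsto' (tendsto_measure_iUnion_atTop hmono) fun n => ?_
  have hpos : 0 < (N : ℝ) * (β - α) := mul_pos (Nat.cast_pos.2 hN) (sub_pos.2 hαβ)
  rw [Function.comp_apply, ← ofReal_measureReal]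
  refine ENNReal.ofReal_le_ofReal ?_
  rw [le_div_iff₀ hpos, mul_comm]
  exact mul_measureReal_upcrossingSet_le hT hf hC hαβ.le hc hfc N n

end Upcrossing

end AlgorithmicErgodic

namespace AlgorithmicErgodic

open MeasureTheory Filter Topology

/-! ### Convergence of Birkhoff averages at random points -/

theorem isOpen_cylinder (x : List Bool) : IsOpen (cylinder x) := by
  have : cylinder x = ⋂ i : Fin x.length, {ω : Cantor | ω i = x[i]} := by
    ext ω
    simp only [cylinder, IsPrefix, Set.mem_ofPred_eq, Set.mem_iInter]
    exact ⟨fun h i => (h i i.2).symm, fun h i hi => (h ⟨i, hi⟩).symm⟩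
  rw [this]
  refine isOpen_iInter_of_finite fun i => ?_
  exact (isOpen_discrete ({x[i]} : Set Bool)).preimage
    (f := fun ω : Cantor => ω i) (continuous_apply (i : ℕ))

theorem EffOpen.isOpen {A : Type*} [Primcodable A] {U : A → Set Cantor} (hU : EffOpen U) (a : A) :
    IsOpen (U a) := by
  obtain ⟨S, -, h⟩ := hU
  have : U a = ⋃ x : {x // S (a, x)}, cylinder x := by
    ext ω
    rw [h, Set.mem_iUnion]
    exact ⟨fun ⟨x, hx, hS⟩ => ⟨⟨x, hS⟩, hx⟩, fun ⟨x, hx⟩ => ⟨x, hx, x.2⟩⟩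
  rw [this]
  exact isOpen_iUnion fun x => isOpen_cylinder _

theorem SimpleCode.measurable_eval (c : SimpleCode) : Measurable fun ω => ((c.eval ω : ℚ) : ℝ) := by
  induction c with
  | nil => simp [SimpleCode.eval]
  | cons p c ih =>
    have : (fun ω => ((SimpleCode.eval (p :: c) ω : ℚ) : ℝ)) =
        fun ω => if IsPrefix p.1 ω then ((p.2.val : ℚ) : ℝ)
          else ((SimpleCode.eval c ω : ℚ) : ℝ) := by
      funext ω
      exact apply_ite (Rat.cast : ℚ → ℝ) _ _ _
    rw [this]
    exact Measurable.ite (isOpen_cylinder p.1).measurableSet measurable_const ih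

theorem SimpleCode.exists_eval_le (c : SimpleCode) : ∃ C : ℕ, ∀ ω, ((c.eval ω : ℚ) : ℝ) ≤ C := by
  induction c with
  | nil => exact ⟨0, fun ω => by simp [SimpleCode.eval]⟩
  | cons p c ih =>
    obtain ⟨C, hC⟩ := ih
    obtain ⟨D, hD⟩ := exists_nat_ge ((p.2.val : ℚ) : ℝ)
    refine ⟨max C D, fun ω => ?_⟩
    change (((if IsPrefix p.1 ω then p.2.val else SimpleCode.eval c ω : ℚ)) : ℝ) ≤ _
    push_cast
    split_ifs
    · exact hD.trans (le_max_right _ _)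
    · exact (hC ω).trans (le_max_left _ _)

theorem UpperSemicomputableFun.measurable {f : Cantor → ℝ} (hf : UpperSemicomputableFun f) :
    Measurable f := by
  obtain ⟨h, -, -, hlim⟩ := hf
  exact measurable_of_tendsto_metrizable (fun n => (h n).measurable_eval) (tendsto_pi_nhds.2 hlim)

/-- The initial simple function of a decreasing approximation is already a bound. A nonnegative
computable function is therefore bounded, as the upcrossing inequality requires. -/
theorem UpperSemicomputableFun.exists_le {f : Cantor → ℝ} (hf : UpperSemicomputableFun f) :
    ∃ C : ℕ, ∀ ω, f ω ≤ C := by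
  obtain ⟨h, -, hanti, hlim⟩ := hf
  obtain ⟨C, hC⟩ := (h 0).exists_eval_le
  exact ⟨C, fun ω => ((antitone_nat_of_succ_le (f := fun n => (((h n).eval ω : ℚ) : ℝ))
    fun n => by exact_mod_cast hanti n ω).le_of_tendsto (hlim ω) 0).trans (hC ω)⟩

theorem exists_eq_div_add_one {r : ℚ} (hr : 0 ≤ r) :
    ∃ k d : ℕ, (r : ℝ) = (k : ℝ) / ((d : ℝ) + 1) := by
  refine ⟨r.num.toNat, r.den - 1, ?_⟩
  have h1 : ((r.den - 1 : ℕ) : ℝ) + 1 = r.den := by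
    exact_mod_cast Nat.sub_add_cancel r.den_pos
  have h2 : ((r.num.toNat : ℕ) : ℝ) = (r.num : ℝ) := by
    exact_mod_cast Int.toNat_of_nonneg (Rat.num_nonneg.2 hr)
  rw [h1, h2, Rat.cast_def]

theorem EffUpper.effOpen_centeredSum_neg {f : Cantor → ℝ} (hf : EffUpper f) (hf0 : ∀ ω, 0 ≤ f ω)
    {T : Cantor → Cantor} (hT : ComputableTransformation T) {r : ℚ} (hr : 0 ≤ r) :
    EffOpen fun n => {ω | centeredSum T f r ω n < 0} := by
  obtain ⟨k, d, hkd⟩ := exists_eq_div_add_one hr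
  refine ((hf.effOpen_birkhoffSum hf0 hT).comp (g := fun n : ℕ => (n, (n * k, d)))
    (Primrec.id.pair ((Primrec.nat_mul.comp Primrec.id (Primrec.const k)).pair
      (Primrec.const d))).to_comp).of_eq fun n ω => ?_
  simp only [Set.mem_ofPred_eq, centeredSum, hkd, sub_neg]
  push_cast
  rw [mul_div_assoc]

/-- Reflection `f ↦ C - f`, `r ↦ C - r` changes the sign of the centered sum and keeps function and
level nonnegative. -/
theorem EffUpper.effOpen_centeredSum_pos {f : Cantor → ℝ} {C : ℕ}
    (hf : EffUpper fun ω => C - f ω) (hfC : ∀ ω, f ω ≤ C)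
    {T : Cantor → Cantor} (hT : ComputableTransformation T) {r : ℚ} (hr : (r : ℝ) ≤ C) :
    EffOpen fun n => {ω | 0 < centeredSum T f r ω n} := by
  have hr' : 0 ≤ (C : ℚ) - r := by
    rw [sub_nonneg]
    exact_mod_cast hr
  refine (hf.effOpen_centeredSum_neg (fun ω => sub_nonneg.2 (hfC ω)) hT hr').of_eq fun n ω => ?_
  have : centeredSum T (fun ω => (C : ℝ) - f ω) ((C - r : ℚ) : ℝ) ω n = -centeredSum T f r ω n := by
    simp only [centeredSum, birkhoffSum, Finset.sum_sub_distrib, Finset.sum_const,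
      Finset.card_range, nsmul_eq_mul]
    push_cast
    ring
  simp only [Set.mem_ofPred_eq, this, neg_lt_zero]

/-- A bounded quantifier over indices replaces the recursion, to make enumerability visible. The
prepended pair `(0, k)` plays the trade before the first, ending at `k`. -/
theorem schedule_iff {n k : ℕ} {s : List (ℕ × ℕ)} :
    Schedule n k s ↔ ∀ i < s.length, (((0, k) :: s).getD i (0, 0)).2 ≤ (s.getD i (0, 0)).1 ∧
      (s.getD i (0, 0)).1 < (s.getD i (0, 0)).2 ∧ (s.getD i (0, 0)).2 ≤ n := by
  induction s generalizing k with
  | nil => simp [Schedule]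
  | cons p s ih =>
    rw [List.length_cons, Nat.forall_lt_succ_left', Schedule, ih]
    have h : ∀ i, (((0, p.2) :: s).getD i (0, 0)).2 = ((p :: s).getD i (0, 0)).2 := by
      intro i
      cases i <;> simp
    simp only [h, List.getD_cons_zero, List.getD_cons_succ, and_assoc]

theorem rePred_schedule : REPred fun q : ℕ × List (ℕ × ℕ) => Schedule q.1 0 q.2 := by
  have hget : Primrec₂ fun (l : List (ℕ × ℕ)) i => l.getD i (0, 0) := Primrec.list_getD (0, 0)
  have h1 : Primrec fun z : (ℕ × List (ℕ × ℕ)) × ℕ => z.1.2.getD z.2 (0, 0) :=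
    hget.comp (Primrec.snd.comp Primrec.fst) Primrec.snd
  have h2 : Primrec fun z : (ℕ × List (ℕ × ℕ)) × ℕ => ((0, 0) :: z.1.2).getD z.2 (0, 0) :=
    hget.comp (Primrec.list_cons.comp (Primrec.const (0, 0)) (Primrec.snd.comp Primrec.fst))
      Primrec.snd
  have h3 : REPred fun z : (ℕ × List (ℕ × ℕ)) × ℕ =>
      (((0, 0) :: z.1.2).getD z.2 (0, 0)).2 ≤ (z.1.2.getD z.2 (0, 0)).1 ∧
      (z.1.2.getD z.2 (0, 0)).1 < (z.1.2.getD z.2 (0, 0)).2 ∧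
      (z.1.2.getD z.2 (0, 0)).2 ≤ z.1.1 :=
    PrimrecPred.rePred ((Primrec.nat_le.comp (Primrec.snd.comp h2) (Primrec.fst.comp h1)).and
      ((Primrec.nat_lt.comp (Primrec.fst.comp h1) (Primrec.snd.comp h1)).and
        (Primrec.nat_le.comp (Primrec.snd.comp h1) (Primrec.fst.comp Primrec.fst))))
  exact (h3.forall_lt.comp (g := fun q : ℕ × List (ℕ × ℕ) => (q, q.2.length))
    (Primrec.id.pair (Primrec.list_length.comp Primrec.snd)).to_comp).of_eq
      fun q => (schedule_iff (n := q.1) (k := 0) (s := q.2)).symm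

theorem effOpen_iUnion_upcrossingSet {f : Cantor → ℝ} {T : Cantor → Cantor} {α β : ℝ}
    (hα : EffOpen fun n => {ω | centeredSum T f α ω n < 0})
    (hβ : EffOpen fun n => {ω | 0 < centeredSum T f β ω n}) :
    EffOpen fun N => ⋃ n, upcrossingSet T f α β N n := by
  have h1 : EffOpen fun q : Unit × (ℕ × ℕ) => {ω | centeredSum T f α ω q.2.1 < 0} ∩
      {ω | 0 < centeredSum T f β ω q.2.2} :=
    (hα.comp (g := fun q : Unit × (ℕ × ℕ) => q.2.1)
      (Computable.fst.comp Computable.snd)).inter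
      (hβ.comp (g := fun q : Unit × (ℕ × ℕ) => q.2.2) (Computable.snd.comp Computable.snd))
  have h2 : EffOpen fun z : ℕ × (ℕ × List (ℕ × ℕ)) => {ω | ∀ p ∈ z.2.2,
      ω ∈ {ω | centeredSum T f α ω p.1 < 0} ∩ {ω | 0 < centeredSum T f β ω p.2}} :=
    h1.iInter_mem_list.comp (g := fun z : ℕ × (ℕ × List (ℕ × ℕ)) => ((), z.2.2))
      ((Computable.const ()).pair (Computable.snd.comp Computable.snd))
  have h3 : EffOpen fun z : ℕ × (ℕ × List (ℕ × ℕ)) =>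
      {_ω : Cantor | Schedule z.2.1 0 z.2.2 ∧ z.2.2.length = z.1} :=
    EffOpen.of_rePred ((rePred_schedule.comp Computable.snd).and (PrimrecPred.rePred
      (Primrec.eq.comp (Primrec.list_length.comp (Primrec.snd.comp Primrec.snd)) Primrec.fst)))
  refine (h3.inter h2).iUnion.of_eq fun N ω => ?_
  simp only [Set.mem_iUnion, Set.mem_inter_iff, Set.mem_ofPred_eq, Prod.exists, upcrossingSet,
    and_assoc]

/-! ### Divergence produces upcrossings; almost everywhere convergence -/

section Oscillation

variable {X : Type*} {T : X → X} {f : X → ℝ}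

theorem birkhoffAverage_lt_iff {n : ℕ} (hn : 0 < n) {α : ℝ} {ω : X} :
    birkhoffAverage ℝ T f n ω < α ↔ centeredSum T f α ω n < 0 := by
  have : (0 : ℝ) < n := Nat.cast_pos.2 hn
  rw [birkhoffAverage, smul_eq_mul, inv_mul_lt_iff₀ this, centeredSum, sub_neg]

theorem lt_birkhoffAverage_iff {n : ℕ} (hn : 0 < n) {α : ℝ} {ω : X} :
    α < birkhoffAverage ℝ T f n ω ↔ 0 < centeredSum T f α ω n := by
  have : (0 : ℝ) < n := Nat.cast_pos.2 hn
  rw [birkhoffAverage, smul_eq_mul, lt_inv_mul_iff₀ this, centeredSum, sub_pos]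

theorem birkhoffAverage_nonneg (hf : ∀ ω, 0 ≤ f ω) (n : ℕ) (ω : X) :
    0 ≤ birkhoffAverage ℝ T f n ω := by
  rw [birkhoffAverage, smul_eq_mul]
  exact mul_nonneg (by positivity) (Finset.sum_nonneg fun i _ => hf _)

theorem birkhoffAverage_le {C : ℝ} (hC : 0 ≤ C) (hf : ∀ ω, f ω ≤ C) (n : ℕ) (ω : X) :
    birkhoffAverage ℝ T f n ω ≤ C := by
  rcases Nat.eq_zero_or_pos n with rfl | hn
  · simpa using hC
  · have : (0 : ℝ) < n := Nat.cast_pos.2 hn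
    rw [birkhoffAverage, smul_eq_mul, inv_mul_le_iff₀ this]
    refine (Finset.sum_le_card_nsmul _ _ C fun i _ => hf _).trans ?_
    simp

theorem mem_iUnion_upcrossingSet_of_frequently {α β : ℝ} {ω : X}
    (hα : ∃ᶠ n in atTop, birkhoffAverage ℝ T f n ω < α)
    (hβ : ∃ᶠ n in atTop, β < birkhoffAverage ℝ T f n ω) (N : ℕ) :
    ω ∈ ⋃ n, upcrossingSet T f α β N n := by
  suffices H : ∀ N k : ℕ, ∃ n s, Schedule n k s ∧ s.length = N ∧
      ∀ p ∈ s, centeredSum T f α ω p.1 < 0 ∧ 0 < centeredSum T f β ω p.2 by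
    obtain ⟨n, s, h⟩ := H N 0
    exact Set.mem_iUnion.2 ⟨n, s, h⟩
  intro N
  induction N with
  | zero => exact fun k => ⟨0, [], trivial, rfl, by simp⟩
  | succ N ih =>
    intro k
    -- Starting at `k + 1` keeps the times positive: at time 0 the average is 0 by convention and
    -- says nothing about the centered sum.
    obtain ⟨u, hu, hku⟩ := (hα.and_eventually (eventually_ge_atTop (k + 1))).exists
    obtain ⟨v, hv, huv⟩ := (hβ.and_eventually (eventually_ge_atTop (u + 1))).exists
    obtain ⟨n, s, hs, hN, hup⟩ := ih v
    refine ⟨max n v, (u, v) :: s, ⟨by dsimp only; omega, huv, le_max_right _ _,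
      hs.mono (le_max_left _ _) le_rfl⟩, by simp [hN], fun p hp => ?_⟩
    rcases List.mem_cons.1 hp with rfl | hp
    · exact ⟨(birkhoffAverage_lt_iff (by omega)).1 hu, (lt_birkhoffAverage_iff (by omega)).1 hv⟩
    · exact hup p hp

/-- Where the Birkhoff averages diverge, they make arbitrarily many upcrossings between two
rational levels. -/
theorem exists_upcrossings_of_not_tendsto {C : ℝ} (hf0 : ∀ ω, 0 ≤ f ω) (hfC : ∀ ω, f ω ≤ C) {ω : X}
    (h : ¬∃ c, Tendsto (fun n => birkhoffAverage ℝ T f n ω) atTop (𝓝 c)) :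
    ∃ α β : ℚ, 0 ≤ α ∧ α < β ∧ (β : ℝ) ≤ C ∧ ∀ N, ω ∈ ⋃ n, upcrossingSet T f α β N n := by
  by_contra! H
  refine h (tendsto_of_no_upcrossings Rat.denseRange_cast ?_ ?_ ?_)
  · rintro _ ⟨α, rfl⟩ _ ⟨β, rfl⟩ hαβ ⟨hα, hβ⟩
    obtain ⟨u, hu⟩ := hα.exists
    obtain ⟨v, hv⟩ := hβ.exists
    have hC : 0 ≤ C := (hf0 ω).trans (hfC ω)
    have h0 : (0 : ℝ) ≤ α := (birkhoffAverage_nonneg hf0 u ω).trans hu.le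
    obtain ⟨N, hN⟩ := H α β (by exact_mod_cast h0) (by exact_mod_cast hαβ)
      (hv.le.trans (birkhoffAverage_le hC hfC v ω))
    exact hN (mem_iUnion_upcrossingSet_of_frequently hα hβ N)
  · exact isBoundedUnder_of ⟨C, fun n => birkhoffAverage_le ((hf0 ω).trans (hfC ω)) hfC n ω⟩
  · exact isBoundedUnder_of ⟨0, fun n => birkhoffAverage_nonneg hf0 n ω⟩

variable [MeasurableSpace X] {μ : Measure X} [IsProbabilityMeasure μ]

theorem measure_iUnion_upcrossingSet_le_div (hT : MeasurePreserving T μ μ) (hf : Measurable f)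
    {C : ℝ} (hf0 : ∀ ω, 0 ≤ f ω) (hfC : ∀ ω, f ω ≤ C) {α β : ℝ} (hα : 0 ≤ α) (hαβ : α < β)
    {N : ℕ} (hN : 0 < N) :
    μ (⋃ n, upcrossingSet T f α β N n) ≤ ENNReal.ofReal (C / (N * (β - α))) := by
  obtain ⟨ω⟩ : Nonempty X := nonempty_of_isProbabilityMeasure μ
  refine measure_iUnion_upcrossingSet_le hT hf (C := C) ?_ hαβ ((hf0 ω).trans (hfC ω)) ?_ hN
  · intro ω
    rw [abs_of_nonneg (hf0 ω)]
    exact hfC ω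
  · intro ω
    linarith [hfC ω]

/-- Birkhoff's pointwise ergodic theorem for bounded functions, without identification of the
limit. -/
theorem ae_exists_tendsto_birkhoffAverage (hT : MeasurePreserving T μ μ) (hf : Measurable f)
    {C : ℝ} (hf0 : ∀ ω, 0 ≤ f ω) (hfC : ∀ ω, f ω ≤ C) :
    ∀ᵐ ω ∂μ, ∃ c, Tendsto (fun n => birkhoffAverage ℝ T f n ω) atTop (𝓝 c) := by
  have h0 : ∀ p : ℚ × ℚ, 0 ≤ p.1 → p.1 < p.2 →
      μ (⋂ N, ⋃ n, upcrossingSet T f p.1 p.2 N n) = 0 := by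
    rintro ⟨α, β⟩ hα hαβ
    have hα' : (0 : ℝ) ≤ α := by exact_mod_cast hα
    have hαβ' : (α : ℝ) < β := by exact_mod_cast hαβ
    have hlim : Tendsto (fun N : ℕ => ENNReal.ofReal (C / (N * ((β : ℝ) - α)))) atTop (𝓝 0) := by
      rw [← ENNReal.ofReal_zero]
      refine ENNReal.tendsto_ofReal (tendsto_const_nhds.div_atTop ?_)
      exact tendsto_natCast_atTop_atTop.atTop_mul_const (sub_pos.2 hαβ')
    refine le_antisymm (ge_of_tendsto hlim ?_) (zero_le)
    filter_upwards [eventually_gt_atTop 0] with N hN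
    exact (measure_mono (Set.iInter_subset _ N)).trans
      (measure_iUnion_upcrossingSet_le_div hT hf hf0 hfC hα' hαβ' hN)
  have h1 : ∀ᵐ ω ∂μ, ∀ p : ℚ × ℚ, 0 ≤ p.1 → p.1 < p.2 →
      ω ∉ ⋂ N, ⋃ n, upcrossingSet T f p.1 p.2 N n := by
    refine ae_all_iff.2 fun p => ?_
    by_cases h : 0 ≤ p.1 ∧ p.1 < p.2
    · filter_upwards [measure_eq_zero_iff_ae_notMem.1 (h0 p h.1 h.2)] with ω hω _ _ using hω
    · exact Eventually.of_forall fun ω h1 h2 => absurd ⟨h1, h2⟩ h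
  filter_upwards [h1] with ω hω
  by_contra h
  obtain ⟨α, β, hα, hαβ, -, hN⟩ := exists_upcrossings_of_not_tendsto hf0 hfC h
  exact hω (α, β) hα hαβ (Set.mem_iInter.2 hN)

end Oscillation

theorem primrec_two_pow : Primrec fun k : ℕ => 2 ^ k :=
  (Primrec.nat_rec₁ 1 (f := fun _ r => r * 2)
    (Primrec.nat_mul.comp Primrec.snd (Primrec.const 2))).of_eq fun k => by
      induction k with
      | zero => rfl
      | succ k ih => rw [pow_succ, ← ih]

/-- The Birkhoff averages of a computable function converge at every Martin-Löf random point. -/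
theorem IsMartinLofRandom.exists_tendsto_birkhoffAverage {P : Measure Cantor}
    [IsProbabilityMeasure P] {f : Cantor → ℝ} (hf0 : ∀ ω, 0 ≤ f ω) (hf : ComputableFun f)
    {T : Cantor → Cantor} (hT : ComputableTransformation T) (hTP : MeasurePreserving T P P)
    {ω : Cantor} (hω : IsMartinLofRandom P ω) :
    ∃ c, Tendsto (fun n => birkhoffAverage ℝ T f n ω) atTop (𝓝 c) := by
  obtain ⟨C, hC⟩ := hf.2.exists_le
  by_contra h
  obtain ⟨α, β, hα, hαβ, hβ, hN⟩ := exists_upcrossings_of_not_tendsto hf0 hC h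
  have hα' : (0 : ℝ) ≤ α := by exact_mod_cast hα
  have hαβ' : (0 : ℝ) < (β : ℝ) - α := by rw [sub_pos]; exact_mod_cast hαβ
  -- With `(K + 1) * 2 ^ k` upcrossings, the factor `K + 1` absorbs `C / (β - α)`, leaving a bound
  -- `2 ^ (-k)`.
  obtain ⟨K, hK⟩ := exists_nat_ge ((C : ℝ) / ((β : ℝ) - α))
  have hopen := effOpen_iUnion_upcrossingSet (hf.2.effUpper.effOpen_centeredSum_neg hf0 hT hα)
    ((hf.1.effUpper_sub C).effOpen_centeredSum_pos hC hT hβ)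
  refine hω (fun k => ⋃ n, upcrossingSet T f α β ((K + 1) * 2 ^ k) n) ⟨?_, fun k => ?_⟩
    (Set.mem_iInter.2 fun k => hN _)
  · exact (hopen.comp (g := fun k => (K + 1) * 2 ^ k)
      (Primrec.nat_mul.comp (Primrec.const (K + 1)) primrec_two_pow).to_comp).uniformlyEffectivelyOpen
  · refine (measure_iUnion_upcrossingSet_le_div hTP hf.2.measurable hf0 hC hα'
      (sub_pos.1 hαβ') (by positivity)).trans ?_
    rw [← ENNReal.ofReal_ofNat, ← ENNReal.ofReal_inv_of_pos (by norm_num),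
      ← ENNReal.ofReal_pow (by norm_num)]
    refine ENNReal.ofReal_le_ofReal ?_
    rw [div_le_iff₀ hαβ'] at hK
    push_cast
    rw [div_le_iff₀ (by positivity)]
    have : (2⁻¹ : ℝ) ^ k * ((K + 1) * 2 ^ k * ((β : ℝ) - α)) = (K + 1) * ((β : ℝ) - α) := by
      rw [inv_pow]
      field_simp
    rw [this]
    linarith

end AlgorithmicErgodic

namespace AlgorithmicErgodic

open MeasureTheory Filter Topology

/-! ### Measures of effectively open sets -/

theorem disjoint_cylinder {x y : List Bool} (hl : x.length = y.length) (h : x ≠ y) :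
    Disjoint (cylinder x) (cylinder y) := by
  refine Set.disjoint_left.2 fun ω hx hy => h ?_
  have hx : IsPrefix x ω := hx
  have hy : IsPrefix y ω := hy
  rw [isPrefix_iff_eq_initSeg.1 hx, isPrefix_iff_eq_initSeg.1 hy, hl]

theorem measureReal_biUnion_cylinder (P : Measure Cantor) [IsFiniteMeasure P] {L : ℕ}
    {F : Finset (List Bool)} (hF : ∀ x ∈ F, x.length = L) :
    P.real (⋃ x ∈ F, cylinder x) = ∑ x ∈ F, P.real (cylinder x) :=
  measureReal_biUnion_finset
    (fun x hx y hy hxy => disjoint_cylinder ((hF x hx).trans (hF y hy).symm) hxy)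
    (fun x _ => (isOpen_cylinder x).measurableSet)

theorem rePred_nodup {A : Type*} [Primcodable A] : REPred fun l : List A => l.Nodup := by
  have h1 : REPred fun z : (List A × ℕ) × ℕ => z.1.1[z.2]? ≠ z.1.1[z.1.2]? :=
    PrimrecPred.rePred (PrimrecPred.not (Primrec.eq.comp
      (Primrec.list_getElem?.comp (Primrec.fst.comp Primrec.fst) Primrec.snd)
      (Primrec.list_getElem?.comp (Primrec.fst.comp Primrec.fst) (Primrec.snd.comp Primrec.fst))))
  have h2 : REPred fun z : List A × ℕ => ∀ i < z.2, z.1[i]? ≠ z.1[z.2]? :=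
    h1.forall_lt.comp (g := fun z : List A × ℕ => (z, z.2)) (Computable.id.pair Computable.snd)
  refine (h2.forall_lt.comp (g := fun l : List A => (l, l.length))
    (Computable.id.pair Computable.list_length)).of_eq fun l => ?_
  rw [List.nodup_iff_getElem?_ne_getElem?]
  exact ⟨fun h i j hij hj => h j hj i hij, fun h j hj i hij => h i j hij hj⟩

theorem LowerSemicomputable.rePred_lt {A : Type} [Primcodable A] {g : A → ℝ}
    (hg : LowerSemicomputable g) :
    REPred fun p : A × (ℕ × ℕ) => (p.2.1 : ℝ) / ((p.2.2 : ℝ) + 1) < g p.1 := by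
  obtain ⟨h, hh, hmono, hlim⟩ := hg
  have hQ : PrimrecRel fun (r : RatCode) (p : ℕ × ℕ) => (p.1 : ℚ) / ((p.2 : ℚ) + 1) < r.val := by
    refine PrimrecRel.of_eq (r := fun (r : RatCode) (p : ℕ × ℕ) =>
      p.1 * (r.2 + 1) + r.1.2 * (p.2 + 1) < r.1.1 * (p.2 + 1)) ?_ fun r p => ?_
    · have a1 : Primrec fun z : RatCode × (ℕ × ℕ) => z.1.1.1 :=
        Primrec.fst.comp (Primrec.fst.comp Primrec.fst)
      have a2 : Primrec fun z : RatCode × (ℕ × ℕ) => z.1.1.2 :=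
        Primrec.snd.comp (Primrec.fst.comp Primrec.fst)
      have a3 : Primrec fun z : RatCode × (ℕ × ℕ) => z.1.2 := Primrec.snd.comp Primrec.fst
      have b1 : Primrec fun z : RatCode × (ℕ × ℕ) => z.2.1 := Primrec.fst.comp Primrec.snd
      have b2 : Primrec fun z : RatCode × (ℕ × ℕ) => z.2.2 := Primrec.snd.comp Primrec.snd
      exact Primrec.nat_lt.comp
        (Primrec.nat_add.comp (primrec_mul_succ b1 a3) (primrec_mul_succ a2 b2))
        (primrec_mul_succ a1 b2)
    · rw [RatCode.val, div_lt_div_iff₀ (by positivity) (by positivity), ← @Nat.cast_lt ℚ]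
      push_cast
      constructor <;> intro h <;> linarith
  have h1 : REPred fun q : (A × (ℕ × ℕ)) × ℕ =>
      (q.1.2.1 : ℚ) / ((q.1.2.2 : ℚ) + 1) < (h q.2 q.1.1).val :=
    (PrimrecPred.rePred hQ).comp (g := fun q : (A × (ℕ × ℕ)) × ℕ => (h q.2 q.1.1, q.1.2))
      ((hh.comp Computable.snd (Computable.fst.comp Computable.fst)).pair
        (Computable.snd.comp Computable.fst))
  refine h1.exists.of_eq fun p => ?_
  have hle : ∀ m, (((h m p.1).val : ℚ) : ℝ) ≤ g p.1 := fun m =>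
    (monotone_nat_of_le_succ (f := fun n => (((h n p.1).val : ℚ) : ℝ))
      fun n => by exact_mod_cast hmono n p.1).ge_of_tendsto (hlim p.1) m
  constructor
  · rintro ⟨m, hm⟩
    have := (Rat.cast_lt (K := ℝ)).2 hm
    push_cast at this
    exact this.trans_le (hle m)
  · intro hp
    obtain ⟨m, hm⟩ := ((hlim p.1).eventually (lt_mem_nhds hp)).exists
    refine ⟨m, ?_⟩
    rw [← Rat.cast_lt (K := ℝ)]
    push_cast
    exact hm

/-- The measures of effectively open sets are uniformly approximable from below. -/
theorem EffOpen.rePred_lt_measureReal {P : Measure Cantor} [IsFiniteMeasure P]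
    (hP : LowerSemicomputable fun x : List Bool => P.real (cylinder x))
    {A : Type*} [Primcodable A] {U : A → Set Cantor} (hU : EffOpen U) :
    REPred fun p : A × (ℕ × ℕ) => (p.2.1 : ℝ) / ((p.2.2 : ℝ) + 1) < P.real (U p.1) := by
  obtain ⟨S, hS, hSm, hSU⟩ := hU.exists_monotone
  -- A certificate lists distinct strings of one length `L`, whose cylinders are therefore disjoint,
  -- with numerators over `D + 1` bounding their measures from below. Numerator 0 is allowed
  -- separately, since a null cylinder has no strict lower bound of this form.
  let W : ((A × ℕ) × ℕ) × (List Bool × ℕ) → Prop := fun z =>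
    (z.2.1.length = z.1.2 ∧ S (z.1.1.1, z.2.1)) ∧
      (z.2.2 = 0 ∨ (z.2.2 : ℝ) / ((z.1.1.2 : ℝ) + 1) < P.real (cylinder z.2.1))
  have hW : REPred W := by
    refine REPred.and (REPred.and (PrimrecPred.rePred ?_) (hS.comp ?_))
      (REPred.or (PrimrecPred.rePred ?_) (hP.rePred_lt.comp
        (g := fun z : ((A × ℕ) × ℕ) × (List Bool × ℕ) => (z.2.1, (z.2.2, z.1.1.2))) ?_))
    · exact Primrec.eq.comp (Primrec.list_length.comp (Primrec.fst.comp Primrec.snd))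
        (Primrec.snd.comp Primrec.fst)
    · exact ((Primrec.fst.comp (Primrec.fst.comp Primrec.fst)).pair
        (Primrec.fst.comp Primrec.snd)).to_comp
    · exact Primrec.eq.comp (Primrec.snd.comp Primrec.snd) (Primrec.const 0)
    · exact ((Primrec.fst.comp Primrec.snd).pair ((Primrec.snd.comp Primrec.snd).pair
        (Primrec.snd.comp (Primrec.fst.comp Primrec.fst)))).to_comp
  let V : (A × (ℕ × ℕ)) × ((ℕ × ℕ) × List (List Bool × ℕ)) → Prop := fun y =>
    (∀ p ∈ y.2.2, W (((y.1.1, y.2.1.1), y.2.1.2), p)) ∧ (y.2.2.map Prod.fst).Nodup ∧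
      y.1.2.1 * (y.2.1.1 + 1) < (y.2.2.map Prod.snd).sum * (y.1.2.2 + 1)
  have hV : REPred V := by
    have hl : Primrec fun y : (A × (ℕ × ℕ)) × ((ℕ × ℕ) × List (List Bool × ℕ)) => y.2.2 :=
      Primrec.snd.comp Primrec.snd
    refine REPred.and (hW.forall_mem_list.comp
      (g := fun y : (A × (ℕ × ℕ)) × ((ℕ × ℕ) × List (List Bool × ℕ)) =>
        (((y.1.1, y.2.1.1), y.2.1.2), y.2.2)) ?_)
      (REPred.and (rePred_nodup.comp ?_) (PrimrecPred.rePred ?_))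
    · exact ((((Primrec.fst.comp Primrec.fst).pair
        (Primrec.fst.comp (Primrec.fst.comp Primrec.snd))).pair
        (Primrec.snd.comp (Primrec.fst.comp Primrec.snd))).pair hl).to_comp
    · exact (Primrec.list_map hl (Primrec.fst.comp₂ Primrec₂.right)).to_comp
    · exact Primrec.nat_lt.comp
        (primrec_mul_succ (Primrec.fst.comp (Primrec.snd.comp Primrec.fst))
          (Primrec.fst.comp (Primrec.fst.comp Primrec.snd)))
        (primrec_mul_succ (primrec_list_sum.comp
          (Primrec.list_map hl (Primrec.snd.comp₂ Primrec₂.right)))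
          (Primrec.snd.comp (Primrec.snd.comp Primrec.fst)))
  refine hV.exists.of_eq ?_
  rintro ⟨a, k, d⟩
  have hd : (0 : ℝ) < (d : ℝ) + 1 := by positivity
  constructor
  · rintro ⟨⟨⟨D, L⟩, l⟩, hl, hnd, hsum⟩
    dsimp only at hl hnd hsum ⊢
    have hD : (0 : ℝ) < (D : ℝ) + 1 := by positivity
    have h1 : ((l.map Prod.snd).sum : ℝ) / ((D : ℝ) + 1) ≤
        (l.map fun p => P.real (cylinder p.1)).sum := by
      rw [Nat.cast_list_sum, List.map_map, div_eq_mul_inv, ← List.sum_map_mul_right]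
      refine List.sum_le_sum fun p hp => ?_
      rcases (hl p hp).2 with h0 | h0
      · have h0 : p.2 = 0 := h0
        simp [h0]
      · simpa [div_eq_mul_inv] using h0.le
    have h2 : (l.map fun p => P.real (cylinder p.1)).sum =
        P.real (⋃ x ∈ (l.map Prod.fst).toFinset, cylinder x) := by
      rw [measureReal_biUnion_cylinder P (L := L), List.sum_toFinset _ hnd, List.map_map]
      · rfl
      · intro x hx
        obtain ⟨p, hp, rfl⟩ := List.mem_map.1 (List.mem_toFinset.1 hx)
        exact (hl p hp).1.1
    have h3 : P.real (⋃ x ∈ (l.map Prod.fst).toFinset, cylinder x) ≤ P.real (U a) := by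
      refine measureReal_mono (Set.iUnion₂_subset fun x hx ω hω => ?_)
      obtain ⟨p, hp, rfl⟩ := List.mem_map.1 (List.mem_toFinset.1 hx)
      exact (hSU a ω).2 ⟨p.1, hω, (hl p hp).1.2⟩
    refine lt_of_lt_of_le ?_ (h1.trans (h2.le.trans h3))
    rw [div_lt_div_iff₀ hd hD]
    exact_mod_cast hsum
  · intro hlt
    dsimp only at hlt
    classical
    -- Closure of `S` under extension makes the unions over level `L` increase to `U a`, so one
    -- level already has measure above the given bound.
    let F : ℕ → Finset (List Bool) := fun L =>
      (List.finite_length_eq Bool L).toFinset.filter fun x => S (a, x)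
    have hF : ∀ L x, x ∈ F L ↔ x.length = L ∧ S (a, x) := fun L x => by simp [F]
    have hmono : Monotone fun L => ⋃ x ∈ F L, cylinder x := by
      intro L M hLM ω hω
      obtain ⟨x, hx, hxω⟩ := Set.mem_iUnion₂.1 hω
      have hxω : IsPrefix x ω := hxω
      obtain ⟨hxL, hxS⟩ := (hF L x).1 hx
      refine Set.mem_iUnion₂.2 ⟨initSeg ω M, (hF M _).2 ⟨by simp, ?_⟩, isPrefix_initSeg ω M⟩
      exact hSm _ _ _ (hxω.prefix_initSeg (by omega)) hxS
    have hU : U a = ⋃ L, ⋃ x ∈ F L, cylinder x := by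
      ext ω
      simp only [hSU, Set.mem_iUnion, hF]
      constructor
      · rintro ⟨x, hx, h⟩
        exact ⟨_, x, ⟨rfl, h⟩, hx⟩
      · rintro ⟨_, x, ⟨-, h⟩, hx⟩
        exact ⟨x, hx, h⟩
    have hlim : Tendsto (fun L => P.real (⋃ x ∈ F L, cylinder x)) atTop (𝓝 (P.real (U a))) := by
      rw [hU]
      exact (ENNReal.tendsto_toReal (measure_ne_top P _)).comp (tendsto_measure_iUnion_atTop hmono)
    obtain ⟨L, hL⟩ := (hlim.eventually (lt_mem_nhds hlt)).exists
    rw [measureReal_biUnion_cylinder P (fun x hx => ((hF L x).1 hx).1)] at hL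
    set σ := ∑ x ∈ F L, P.real (cylinder x) with hσ
    obtain ⟨D, hD⟩ := exists_nat_gt (((F L).card : ℝ) / (σ - (k : ℝ) / ((d : ℝ) + 1)))
    have hD1 : (0 : ℝ) < (D : ℝ) + 1 := by positivity
    -- The largest numerator strictly below the measure, or 0 for a null cylinder. It loses at most
    -- 1, and `D` was chosen so that these losses fit into the slack.
    let m : List Bool → ℕ := fun x => ⌈P.real (cylinder x) * ((D : ℝ) + 1)⌉₊ - 1
    refine ⟨((D, L), (F L).toList.map fun x => (x, m x)), ?_, ?_, ?_⟩
    · intro p hp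
      obtain ⟨x, hx, rfl⟩ := List.mem_map.1 hp
      refine ⟨(hF L x).1 (Finset.mem_toList.1 hx), ?_⟩
      rcases Nat.eq_zero_or_pos (m x) with h0 | h0
      · exact Or.inl h0
      · refine Or.inr ?_
        dsimp only
        rw [div_lt_iff₀ hD1]
        have hm : m x = ⌈P.real (cylinder x) * ((D : ℝ) + 1)⌉₊ - 1 := rfl
        exact Nat.lt_ceil.1 (by omega)
    · rw [List.map_map]
      exact (List.map_id (F L).toList).symm ▸ (F L).nodup_toList
    · have hsum : (((F L).toList.map fun x => (x, m x)).map Prod.snd).sum = ∑ x ∈ F L, m x := by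
        rw [List.map_map, ← Finset.sum_map_toList]
        rfl
      dsimp only
      rw [hsum]
      have hs : σ * ((D : ℝ) + 1) - (F L).card ≤ ∑ x ∈ F L, (m x : ℝ) := by
        have : ((F L).card : ℝ) = ∑ x ∈ F L, (1 : ℝ) := by simp
        rw [this, hσ, Finset.sum_mul, ← Finset.sum_sub_distrib]
        refine Finset.sum_le_sum fun x _ => ?_
        have h1 := Nat.le_ceil (P.real (cylinder x) * ((D : ℝ) + 1))
        have h2 : ((⌈P.real (cylinder x) * ((D : ℝ) + 1)⌉₊ : ℕ) : ℝ) ≤ (m x : ℝ) + 1 := by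
          rw [← Nat.cast_add_one (m x), Nat.cast_le]
          exact Nat.le_add_of_sub_le le_rfl
        linarith
      rw [div_lt_iff₀ (sub_pos.2 hL)] at hD
      rw [← @Nat.cast_lt ℝ]
      push_cast
      have hk : (k : ℝ) = (k : ℝ) / ((d : ℝ) + 1) * ((d : ℝ) + 1) := by field_simp
      have h0 := sub_pos.2 hL
      calc (k : ℝ) * ((D : ℝ) + 1)
          = ((k : ℝ) / ((d : ℝ) + 1) * ((D : ℝ) + 1)) * ((d : ℝ) + 1) := by
            rw [mul_right_comm, ← hk]
        _ < (∑ x ∈ F L, (m x : ℝ)) * ((d : ℝ) + 1) := by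
            gcongr
            refine lt_of_lt_of_le ?_ hs
            nlinarith

/-- If the points of the effectively open sets `U n` are typical for large `n`, then no random point
belongs to sets `V n` that are effectively open and disjoint from `U n` for all large `n`. -/
theorem IsMartinLofRandom.not_eventually_mem {P : Measure Cantor} [IsProbabilityMeasure P]
    (hP : ComputableMeasure P) {U V : ℕ → Set Cantor} (hU : EffOpen U) (hV : EffOpen V)
    (hUV : ∀ n, Disjoint (U n) (V n)) (hae : ∀ᵐ ω ∂P, ∀ᶠ n in atTop, ω ∈ U n) {ω : Cantor}
    (hω : IsMartinLofRandom P ω) : ¬∀ᶠ n in atTop, ω ∈ V n := by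
  intro hev
  have hlim : Tendsto (fun n => P.real (U n)) atTop (𝓝 1) := by
    have h1 : Tendsto (fun n => P (U n)) atTop (𝓝 (P Set.univ)) := by
      refine tendsto_measure_of_ae_tendsto_indicator_of_isFiniteMeasure atTop MeasurableSet.univ
        (fun n => (hU.isOpen n).measurableSet) ?_
      filter_upwards [hae] with ω hω
      filter_upwards [hω] with n hn
      simp [hn]
    rw [measure_univ] at h1
    exact (ENNReal.tendsto_toReal ENNReal.one_ne_top).comp h1
  -- The fraction is `1 - 2 ^ (-k)` in the form numerator over denominator-plus-one. Requiring the
  -- time to be at least `k` makes the chosen times tend to infinity.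
  have hre : REPred fun p : ℕ × ℕ => p.1 ≤ p.2 ∧
      ((2 ^ p.1 - 1 : ℕ) : ℝ) / (((2 ^ p.1 - 1 : ℕ) : ℝ) + 1) < P.real (U p.2) := by
    refine REPred.and (PrimrecPred.rePred Primrec.nat_le)
      ((hU.rePred_lt_measureReal hP.1).comp
        (g := fun p : ℕ × ℕ => (p.2, (2 ^ p.1 - 1, 2 ^ p.1 - 1))) ?_)
    have h1 : Primrec fun p : ℕ × ℕ => 2 ^ p.1 - 1 :=
      Primrec.nat_sub.comp (primrec_two_pow.comp Primrec.fst) (Primrec.const 1)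
    exact (Primrec.snd.pair (h1.pair h1)).to_comp
  have hval : ∀ k : ℕ, ((2 ^ k - 1 : ℕ) : ℝ) / (((2 ^ k - 1 : ℕ) : ℝ) + 1) = 1 - 2⁻¹ ^ k := by
    intro k
    rw [Nat.cast_sub Nat.one_le_two_pow]
    push_cast
    rw [sub_add_cancel, sub_div, div_self (by positivity), inv_pow, one_div]
  obtain ⟨g, hg, hgU⟩ := hre.exists_computable_choice fun k => by
    have hlt : ((2 ^ k - 1 : ℕ) : ℝ) / (((2 ^ k - 1 : ℕ) : ℝ) + 1) < 1 := by
      rw [hval]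
      have : (0 : ℝ) < 2⁻¹ ^ k := by positivity
      linarith
    obtain ⟨n, hn, hkn⟩ := ((hlim.eventually (lt_mem_nhds hlt)).and (eventually_ge_atTop k)).exists
    exact ⟨n, hkn, hn⟩
  have hVg : ∀ k, P (V (g k)) ≤ 2⁻¹ ^ k := by
    intro k
    have h1 : P.real (V (g k)) ≤ 2⁻¹ ^ k := by
      have h2 := (hgU k).2
      dsimp only at h2
      rw [hval] at h2
      have h3 : P.real (U (g k)) + P.real (V (g k)) ≤ 1 := by
        rw [← measureReal_union (hUV _) (hV.isOpen _).measurableSet]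
        exact measureReal_le_one
      linarith
    rw [← ofReal_measureReal, ← ENNReal.ofReal_ofNat, ← ENNReal.ofReal_inv_of_pos (by norm_num),
      ← ENNReal.ofReal_pow (by norm_num)]
    exact ENNReal.ofReal_le_ofReal h1
  -- The union over a tail needs only one late index with `ω` in the set, so the unknown time from
  -- which `ω ∈ V n` holds need not be computed. The shift by 1 makes the geometric series sum to `2
  -- ^ (-k)`.
  refine hω (fun k => ⋃ j, V (g (k + 1 + j))) ⟨?_, fun k => ?_⟩ (Set.mem_iInter.2 fun k => ?_)
  · refine EffOpen.uniformlyEffectivelyOpen (EffOpen.iUnion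
      (U := fun p : ℕ × ℕ => V (g (p.1 + 1 + p.2))) (hV.comp (hg.comp ?_)))
    exact (Primrec.nat_add.comp (Primrec.succ.comp Primrec.fst) Primrec.snd).to_comp
  · calc P (⋃ j, V (g (k + 1 + j))) ≤ ∑' j, P (V (g (k + 1 + j))) := measure_iUnion_le _
      _ ≤ ∑' j, (2⁻¹ : ENNReal) ^ (k + 1 + j) := ENNReal.tsum_le_tsum fun j => hVg _
      _ = 2⁻¹ ^ k := by
        simp only [pow_add, ENNReal.tsum_mul_left, ENNReal.tsum_geometric, pow_one,
          ENNReal.one_sub_inv_two, inv_inv]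
        rw [mul_assoc, ENNReal.inv_mul_cancel (by norm_num) (by norm_num), mul_one]
  · obtain ⟨n₀, hn₀⟩ := eventually_atTop.1 hev
    refine Set.mem_iUnion.2 ⟨n₀, hn₀ _ (le_trans ?_ (hgU (k + 1 + n₀)).1)⟩
    dsimp only
    omega

end AlgorithmicErgodic

namespace AlgorithmicErgodic

open MeasureTheory Filter Topology

/-! ### The ergodic theorem for random points -/

/-! ### The limit function: invariance, integral, ergodic case -/

section Limit

variable {X : Type*} (T : X → X) (f : X → ℝ)

open Classical in
/-- The limit of the Birkhoff averages where it exists, and `0` elsewhere. -/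
noncomputable def birkhoffLimit (ω : X) : ℝ :=
  if h : ∃ c, Tendsto (fun n => birkhoffAverage ℝ T f n ω) atTop (𝓝 c) then h.choose else 0

variable {T f}

theorem tendsto_birkhoffLimit {ω : X}
    (h : ∃ c, Tendsto (fun n => birkhoffAverage ℝ T f n ω) atTop (𝓝 c)) :
    Tendsto (fun n => birkhoffAverage ℝ T f n ω) atTop (𝓝 (birkhoffLimit T f ω)) := by
  rw [birkhoffLimit, dif_pos h]
  exact h.choose_spec

/-- For bounded `f` the averages at `ω` and `T ω` differ by a null sequence, so they converge
together and to the same limit. Where they diverge, the default 0 is taken at both points;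
invariance thus holds everywhere. -/
theorem birkhoffLimit_apply {C : ℝ} (hf0 : ∀ ω, 0 ≤ f ω) (hfC : ∀ ω, f ω ≤ C) (ω : X) :
    birkhoffLimit T f (T ω) = birkhoffLimit T f ω := by
  have hb : Bornology.IsBounded (Set.range f) :=
    (Metric.isBounded_Icc 0 C).subset (by rintro _ ⟨ω, rfl⟩; exact ⟨hf0 ω, hfC ω⟩)
  have h0 := tendsto_birkhoffAverage_apply_sub_birkhoffAverage' ℝ hb T ω
  have hiff : ∀ c, Tendsto (fun n => birkhoffAverage ℝ T f n (T ω)) atTop (𝓝 c) ↔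
      Tendsto (fun n => birkhoffAverage ℝ T f n ω) atTop (𝓝 c) := by
    intro c
    constructor
    · intro h
      simpa using h.sub h0
    · intro h
      simpa using h.add h0
  by_cases h : ∃ c, Tendsto (fun n => birkhoffAverage ℝ T f n ω) atTop (𝓝 c)
  · have h' : ∃ c, Tendsto (fun n => birkhoffAverage ℝ T f n (T ω)) atTop (𝓝 c) :=
      h.imp fun c => (hiff c).2
    exact tendsto_nhds_unique ((hiff _).1 (tendsto_birkhoffLimit h')) (tendsto_birkhoffLimit h)
  · have h' : ¬∃ c, Tendsto (fun n => birkhoffAverage ℝ T f n (T ω)) atTop (𝓝 c) :=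
      fun ⟨c, hc⟩ => h ⟨c, (hiff c).1 hc⟩
    rw [birkhoffLimit, birkhoffLimit, dif_neg h, dif_neg h']

variable [MeasurableSpace X] {μ : Measure X}

theorem integral_birkhoffAverage (hT : MeasurePreserving T μ μ) (hf : Integrable f μ) {n : ℕ}
    (hn : 0 < n) : ∫ ω, birkhoffAverage ℝ T f n ω ∂μ = ∫ ω, f ω ∂μ := by
  have h1 : ∀ i, ∫ ω, f (T^[i] ω) ∂μ = ∫ ω, f ω ∂μ := by
    intro i
    have hi := hT.iterate i
    conv_rhs => rw [← hi.map_eq]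
    rw [integral_map hi.measurable.aemeasurable (by rw [hi.map_eq]; exact hf.aestronglyMeasurable)]
  simp only [birkhoffAverage, birkhoffSum, smul_eq_mul]
  have h2 : ∀ i ∈ Finset.range n, Integrable (fun ω => f (T^[i] ω)) μ := fun i _ =>
    (hT.iterate i).integrable_comp_of_integrable hf
  rw [integral_const_mul, integral_finsetSum _ h2]
  simp only [h1, Finset.sum_const, Finset.card_range, nsmul_eq_mul]
  have : (n : ℝ) ≠ 0 := by positivity
  field_simp

variable [IsProbabilityMeasure μ]

theorem integrable_birkhoffLimit (hT : MeasurePreserving T μ μ) (hf : Measurable f)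
    {C : ℝ} (hf0 : ∀ ω, 0 ≤ f ω) (hfC : ∀ ω, f ω ≤ C) :
    Integrable (birkhoffLimit T f) μ ∧ ∫ ω, birkhoffLimit T f ω ∂μ = ∫ ω, f ω ∂μ := by
  have hae : ∀ᵐ ω ∂μ, Tendsto (fun n => birkhoffAverage ℝ T f n ω) atTop
      (𝓝 (birkhoffLimit T f ω)) := by
    filter_upwards [ae_exists_tendsto_birkhoffAverage hT hf hf0 hfC] with ω hω
    exact tendsto_birkhoffLimit hω
  have hmeas : ∀ n, Measurable fun ω => birkhoffAverage ℝ T f n ω := by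
    intro n
    simp only [birkhoffAverage, birkhoffSum]
    exact (Finset.measurable_sum _ fun i _ => hf.comp (hT.measurable.iterate i)).const_smul
      ((n : ℝ)⁻¹)
  have hC : ∀ ω : X, 0 ≤ C := fun ω => (hf0 ω).trans (hfC ω)
  have hbound : ∀ n ω, ‖birkhoffAverage ℝ T f n ω‖ ≤ C := fun n ω => by
    rw [Real.norm_of_nonneg (birkhoffAverage_nonneg hf0 n ω)]
    exact birkhoffAverage_le (hC ω) hfC n ω
  have hfi : Integrable f μ := Integrable.of_bound hf.aestronglyMeasurable C
    (Eventually.of_forall fun ω => by rw [Real.norm_of_nonneg (hf0 ω)]; exact hfC ω)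
  constructor
  · refine Integrable.of_bound (aestronglyMeasurable_of_tendsto_ae atTop
      (fun n => (hmeas n).aestronglyMeasurable) hae) C ?_
    filter_upwards [hae] with ω hω
    exact le_of_tendsto' hω.norm fun n => hbound n ω
  · have h1 := tendsto_integral_of_dominated_convergence (fun _ => C)
      (fun n => (hmeas n).aestronglyMeasurable) (integrable_const C)
      (fun n => Eventually.of_forall fun ω => hbound n ω) hae
    refine tendsto_nhds_unique h1 (tendsto_const_nhds.congr' ?_)
    filter_upwards [eventually_gt_atTop 0] with n hn
    exact (integral_birkhoffAverage hT hfi hn).symm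

/-- Ergodicity makes the invariant limit almost everywhere constant, and conservation of the
integral identifies the constant. -/
theorem ae_birkhoffLimit_eq_integral (hT : Ergodic T μ) (hf : Measurable f)
    {C : ℝ} (hf0 : ∀ ω, 0 ≤ f ω) (hfC : ∀ ω, f ω ≤ C) :
    ∀ᵐ ω ∂μ, birkhoffLimit T f ω = ∫ α, f α ∂μ := by
  obtain ⟨hi, hint⟩ := integrable_birkhoffLimit hT.toMeasurePreserving hf hf0 hfC
  obtain ⟨c, hc⟩ := hT.ae_eq_const_of_ae_eq_comp_ae hi.aestronglyMeasurable
    (Eventually.of_forall fun ω => birkhoffLimit_apply hf0 hfC ω)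
  have hcI : ∫ α, f α ∂μ = c := by
    rw [← hint, integral_congr_ae hc]
    simp
  filter_upwards [hc] with ω hω
  rw [hω, hcI, Function.const_apply]

end Limit

/-- For an ergodic transformation, the Birkhoff averages at random points converge to the space
average. -/
theorem IsMartinLofRandom.birkhoffLimit_eq_integral {P : Measure Cantor} [IsProbabilityMeasure P]
    (hP : ComputableMeasure P) {f : Cantor → ℝ} (hf0 : ∀ ω, 0 ≤ f ω) (hf : ComputableFun f)
    {T : Cantor → Cantor} (hT : ComputableTransformation T) (hTP : Ergodic T P)
    {ω : Cantor} (hω : IsMartinLofRandom P ω) :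
    birkhoffLimit T f ω = ∫ α, f α ∂P := by
  obtain ⟨C, hC⟩ := hf.2.exists_le
  have hmeas := hf.2.measurable
  have hmp := hTP.toMeasurePreserving
  set c := ∫ α, f α ∂P with hc
  have hae : ∀ᵐ ω ∂P, Tendsto (fun n => birkhoffAverage ℝ T f n ω) atTop (𝓝 c) := by
    filter_upwards [ae_exists_tendsto_birkhoffAverage hmp hmeas hf0 hC,
      ae_birkhoffLimit_eq_integral hTP hmeas hf0 hC] with ω h1 h2
    have := tendsto_birkhoffLimit h1
    rwa [h2] at this
  have hlim := tendsto_birkhoffLimit (hω.exists_tendsto_birkhoffAverage hf0 hf hT hmp)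
  have hbd : ∀ {ω : Cantor} {x : ℝ}, Tendsto (fun n => birkhoffAverage ℝ T f n ω) atTop (𝓝 x) →
      0 ≤ x ∧ x ≤ C := fun {ω} {x} h =>
    ⟨ge_of_tendsto' h fun n => birkhoffAverage_nonneg hf0 n ω,
      le_of_tendsto' h fun n => birkhoffAverage_le (Nat.cast_nonneg C) hC n ω⟩
  obtain ⟨ω₀, hω₀⟩ := hae.exists
  -- Both the limit at `ω` and the space average `c` lie in `[0, C]`, so a rational strictly between
  -- them is in the range where both half-line conditions are effectively open.
  have hopen : ∀ r : ℚ, (0 : ℝ) < r → (r : ℝ) < C →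
      EffOpen (fun n => {ω | centeredSum T f r ω n < 0}) ∧
        EffOpen (fun n => {ω | 0 < centeredSum T f r ω n}) := fun r h0 hrC =>
    ⟨hf.2.effUpper.effOpen_centeredSum_neg hf0 hT (by exact_mod_cast h0.le),
      (hf.1.effUpper_sub C).effOpen_centeredSum_pos hC hT hrC.le⟩
  have hneg : ∀ {ω : Cantor} {x r : ℝ}, Tendsto (fun n => birkhoffAverage ℝ T f n ω) atTop (𝓝 x) →
      x < r → ∀ᶠ n in atTop, ω ∈ {ω | centeredSum T f r ω n < 0} := by
    intro ω x r h hr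
    filter_upwards [h.eventually (gt_mem_nhds hr), eventually_gt_atTop 0] with n h1 h2
    exact (birkhoffAverage_lt_iff h2).1 h1
  have hpos : ∀ {ω : Cantor} {x r : ℝ}, Tendsto (fun n => birkhoffAverage ℝ T f n ω) atTop (𝓝 x) →
      r < x → ∀ᶠ n in atTop, ω ∈ {ω | 0 < centeredSum T f r ω n} := by
    intro ω x r h hr
    filter_upwards [h.eventually (lt_mem_nhds hr), eventually_gt_atTop 0] with n h1 h2
    exact (lt_birkhoffAverage_iff h2).1 h1
  have hdisj : ∀ (r : ℝ) (n : ℕ), Disjoint {ω | centeredSum T f r ω n < 0}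
      {ω | 0 < centeredSum T f r ω n} := fun r n => by
    refine Set.disjoint_left.2 fun ω h1 h2 => ?_
    rw [Set.mem_ofPred_eq] at h1 h2
    exact lt_asymm h1 h2
  rcases lt_trichotomy (birkhoffLimit T f ω) c with hlt | heq | hlt
  · obtain ⟨r, hr1, hr2⟩ := exists_rat_btwn hlt
    obtain ⟨h1, h2⟩ := hopen r ((hbd hlim).1.trans_lt hr1) (hr2.trans_le (hbd hω₀).2)
    exact absurd (hneg hlim hr1) (hω.not_eventually_mem hP h2 h1 (fun n => (hdisj r n).symm)
      (hae.mono fun ω h => hpos h hr2))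
  · exact heq
  · obtain ⟨r, hr1, hr2⟩ := exists_rat_btwn hlt
    obtain ⟨h1, h2⟩ := hopen r ((hbd hω₀).1.trans_lt hr1) (hr2.trans_le (hbd hlim).2)
    exact absurd (hpos hlim hr2) (hω.not_eventually_mem hP h1 h2 (hdisj r)
      (hae.mono fun ω h => hneg h hr1))

end AlgorithmicErgodic

theorem mainTheorem1
    (P : MeasureTheory.Measure AlgorithmicErgodic.Cantor) [MeasureTheory.IsProbabilityMeasure P]
    (hP : AlgorithmicErgodic.ComputableMeasure P)
    (f : AlgorithmicErgodic.Cantor → ℝ) (hf_nonneg : ∀ ω, 0 ≤ f ω)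
    (hf : AlgorithmicErgodic.ComputableFun f) (hf_int : MeasureTheory.Integrable f P)
    (T : AlgorithmicErgodic.Cantor → AlgorithmicErgodic.Cantor)
    (hT : AlgorithmicErgodic.ComputableTransformation T)
    (hTP : MeasureTheory.MeasurePreserving T P P) :
    ∃ f' : AlgorithmicErgodic.Cantor → ℝ,
      MeasureTheory.Integrable f' P ∧
      (∀ ω, f' (T ω) = f' ω) ∧
      ∫ ω, f' ω ∂P = ∫ ω, f ω ∂P ∧
      (∀ ω, AlgorithmicErgodic.IsMartinLofRandom P ω →
        Filter.Tendsto (fun n : ℕ => birkhoffAverage ℝ T f n ω) Filter.atTop (nhds (f' ω))) ∧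
      (Ergodic T P →
        ∀ ω, AlgorithmicErgodic.IsMartinLofRandom P ω → f' ω = ∫ α, f α ∂P) := by
  obtain ⟨C, hC⟩ := hf.2.exists_le
  obtain ⟨hi, hint⟩ :=
    AlgorithmicErgodic.integrable_birkhoffLimit hTP hf.2.measurable hf_nonneg hC
  exact ⟨AlgorithmicErgodic.birkhoffLimit T f, hi,
    AlgorithmicErgodic.birkhoffLimit_apply hf_nonneg hC, hint,
    fun ω hω => AlgorithmicErgodic.tendsto_birkhoffLimit
      (hω.exists_tendsto_birkhoffAverage hf_nonneg hf hT hTP),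
    fun hE ω hω => hω.birkhoffLimit_eq_integral hP hf_nonneg hf hT hE⟩
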